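/- Let $\Omega=C([0,\infty),\mathbb{R})$, $S_t(\omega)=\omega(t)$, and $\mathcal{F}_t=\sigma(S_s:s\le t)$. A simple strategy is $H_t=\sum_{k\ge 0}F_k\mathbf{1}_{(\tau_k,\tau_{k+1}]}(t)$ with $(\mathcal F_t)$-stopping times $0=\tau_0<\tau_1<\cdots$ with values in $[0,\infty]$ (strictly increasing as long as they are finite) such that on every path $\tau_k\le t$ for only finitely many $k$, for each $t<\infty$, and with bounded $\mathcal{F}_{\tau_k}$-measurable $F_k\colon\Omega\to\mathbb{R}$; its gains are $(H\cdot S)_t=\sum_{k\ge 0}F_k\,(S_{\tau_{k+1}\wedge t}-S_{\tau_k\wedge t})$. For $\lambda>0$ let $\mathcal{H}_\lambda$ be the set of simple strategies with $(H\cdot S)_t(\omega)\ge-\lambda$ for all $t\ge 0$ and $\omega\in\Omega$. For $A\subseteq\Omega$ let $$\overline{P}(A)=\inf\Big\{\lambda>0:\ \exists (H^n)_{n\in\mathbb N}\subseteq\mathcal{H}_\lambda\ \text{ with }\ \liminf_{t\to\infty}\liminf_{n\to\infty}\big(\lambda+(H^n\cdot S)_t(\omega)\big)\ge\mathbf{1}_A(\omega)\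 \ \forall\omega\in\Omega\Big\}.$$ A property holds for typical price paths if the set of $\omega$ where it fails has $\overline{P}$-measure $0$. For $n\in\mathbb{N}=\{0,1,2,\dots\}$ let $\mathbb{D}^n=\{m2^{-n}:m\in\mathbb{Z}\}$, and let $\pi^n=(\tau^n_k)_{k\ge 0}$ be the dyadic Lebesgue partition generated by $S$: $\tau^n_0=0$ and $\tau^n_{k+1}=\inf\{t\ge\tau^n_k: S_t\in\mathbb{D}^n\setminus\{S_{\tau^n_k}\}\}$ (with $\inf\emptyset=\infty$). Define the discrete local time $$L^{\pi^n}_t(u)=\sum_{k\ge 0}\mathbf{1}_{(\min(a_k,a_{k+1}),\,\max(a_k,a_{k+1})]}(u)\,|a_{k+1}-u|,\qquad a_k=S_{\tau^n_k\wedge t},\quad t\ge0,\ u\in\mathbb{R}.$$ **Theorem.** Let $T>0$ and $\alpha\in(0,1/2)$. For typical price paths there is a function $L\in C([0,T],C^\alpha(\mathbb{R}))$, where $C^\alpha(\mathbb{R})$ is the space of bounded $\alpha$-Hölder continuous functions with norm $\|f\|_\infty+\sup_{u\ne v}|f(u)-f(v)|/|u-v|^\alpha$, such that $L^{\pi^n}_t(u)\to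 L_t(u)$ uniformly in $(t,u)\in[0,T]\times\mathbb{R}$ as $n\to\infty$, and there is a constant $C>0$, depending on the path, such that $$\sup_{n\in\mathbb{N}}\ 2^{n\alpha}\sup_{(t,u)\in[0,T]\times\mathbb{R}}\big|L^{\pi^n}_t(u)-L_t(u)\big|\le C.$$ Moreover, for every $p>2$, for typical price paths $$\sup_{n\in\mathbb{N}}\ \sup_{t\in[0,T]}\ \sup\Big\{\Big(\sum_{k=1}^N|L^{\pi^n}_t(u_k)-L^{\pi^n}_t(u_{k-1})|^p\Big)^{1/p}:\ N\in\mathbb{N},\ u_0<\dots<u_N\Big\}<\infty.$$ -/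

import Mathlib

open MeasureTheory Filter Topology
open scoped NNReal ENNReal

namespace VovkLocalTime

noncomputable section

/-- The sample space `Ω = C([0,∞), ℝ)`. The coordinate process is `S_t(ω) = ω t`. -/
abbrev PricePath : Type := C(ℝ≥0, ℝ)

/-- The σ-algebra on `Ω` generated by all coordinates. -/
abbrev pathSigma : MeasurableSpace PricePath :=
  ⨆ s : ℝ≥0, MeasurableSpace.comap (fun ω : PricePath => ω s) (borel ℝ)

/-- The (raw) filtration `𝓕_t = σ(S_s : s ≤ t)` of the coordinate process. -/
def pathFiltration : Filtration ℝ≥0 pathSigma where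
  seq t := ⨆ s : ℝ≥0, ⨆ _ : s ≤ t,
    MeasurableSpace.comap (fun ω : PricePath => ω s) (borel ℝ)
  mono' _ _ hab := biSup_mono fun _ hs => le_trans hs hab
  le' _ := iSup₂_le fun s _ =>
    le_iSup (fun s : ℝ≥0 => MeasurableSpace.comap (fun ω : PricePath => ω s) (borel ℝ)) s

/-- The value `S_{τ ∧ t}` for a time `τ ∈ [0,∞]` and `t ∈ [0,∞)`. The minimum is finite, so
the default value of `untopA` plays no role. -/
def valueAtMin (S : PricePath) (τ : WithTop ℝ≥0) (t : ℝ≥0) : ℝ :=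
  S (min (t : WithTop ℝ≥0) τ).untopA

/-- A simple strategy `H = ∑ₖ Fₖ 1_{(τₖ, τₖ₊₁]}`: stopping times `0 = τ₀ < τ₁ < ⋯` with values
in `[0,∞]` (strictly increasing as long as they are finite), only finitely many of them below any
finite time on each path, and bounded `𝓕_{τₖ}`-measurable positions `Fₖ`. -/
structure SimpleStrategy where
  τ : ℕ → PricePath → WithTop ℝ≥0
  isStoppingTime : ∀ k, IsStoppingTime pathFiltration (τ k)
  τ_zero : ∀ ω, τ 0 ω = 0
  τ_mono : ∀ k ω, τ k ω ≤ τ (k + 1) ω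
  τ_strict : ∀ k ω, τ k ω ≠ ⊤ → τ k ω < τ (k + 1) ω
  τ_finite : ∀ (ω : PricePath) (T : ℝ≥0), {k : ℕ | τ k ω ≤ (T : WithTop ℝ≥0)}.Finite
  F : ℕ → PricePath → ℝ
  F_measurable : ∀ k, Measurable[(isStoppingTime k).measurableSpace] (F k)
  F_bounded : ∀ k, ∃ C : ℝ, ∀ ω, |F k ω| ≤ C

/-- The integral `(H · S)_t(ω) = ∑ₖ Fₖ(ω) (S_{τₖ₊₁ ∧ t}(ω) - S_{τₖ ∧ t}(ω))`. All terms with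
`τₖ(ω) ≥ t` vanish, so the sum has only finitely many nonzero terms. -/
def SimpleStrategy.integral (H : SimpleStrategy) (t : ℝ≥0) (ω : PricePath) : ℝ :=
  ∑' k : ℕ, H.F k ω * (valueAtMin ω (H.τ (k + 1) ω) t - valueAtMin ω (H.τ k ω) t)

/-- `lam`-admissibility: the gains never fall below `-lam`, on any path. -/
def SimpleStrategy.Admissible (H : SimpleStrategy) (lam : ℝ) : Prop :=
  ∀ (t : ℝ≥0) (ω : PricePath), -lam ≤ H.integral t ω

/-- The initial capital `lam` suffices to superhedge the indicator of `A` in the limit, along some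
sequence of `lam`-admissible simple strategies (the limits inferior are taken in `[-∞,∞]`). -/
def Superhedges (lam : ℝ) (A : Set PricePath) : Prop :=
  ∃ H : ℕ → SimpleStrategy, (∀ n, (H n).Admissible lam) ∧
    ∀ ω : PricePath,
      A.indicator (fun _ => (1 : EReal)) ω ≤
        liminf (fun t : ℝ≥0 =>
          liminf (fun n : ℕ => ((lam + (H n).integral t ω : ℝ) : EReal)) atTop) atTop

/-- The outer measure of `A`: the cheapest superhedging price of the indicator of `A`. -/
def outerMeasure (A : Set PricePath) : ℝ≥0∞ :=
  ⨅ (lam : ℝ) (_ : 0 < lam) (_ : Superhedges lam A), ENNReal.ofReal lam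

/-- A property holds for typical price paths if the set where it is violated is a null set. -/
def ForTypicalPaths (P : PricePath → Prop) : Prop :=
  outerMeasure {ω | ¬ P ω} = 0

/-- The dyadic grid `𝔻ⁿ = {m 2⁻ⁿ : m ∈ ℤ}`. -/
def dyadicGrid (n : ℕ) : Set ℝ :=
  {x | ∃ m : ℤ, x = (m : ℝ) * ((2 : ℝ) ^ n)⁻¹}

/-- The dyadic Lebesgue partition generated by the path `S`: `τⁿ₀ = 0` and
`τⁿₖ₊₁ = inf {t ≥ τⁿₖ : S_t ∈ 𝔻ⁿ \ {S_{τⁿₖ}}}`, with `inf ∅ = ∞`. If `τⁿₖ = ∞`, there is no finite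
`t ≥ τⁿₖ`, so also `τⁿₖ₊₁ = ∞`. -/
def lebesguePartition (S : PricePath) (n : ℕ) : ℕ → WithTop ℝ≥0
  | 0 => 0
  | k + 1 => sInf ((fun t : ℝ≥0 => (t : WithTop ℝ≥0)) ''
      {t : ℝ≥0 | lebesguePartition S n k ≤ (t : WithTop ℝ≥0) ∧
        S t ∈ dyadicGrid n \ {S (lebesguePartition S n k).untopA}})

/-- The discrete local time of `S` along the partition `π = {π 0 < π 1 < ⋯}` (times in `[0,∞]`),
`L^π_t(S,u) = ∑ⱼ 1_{⦅S_{tⱼ∧t}, S_{tⱼ₊₁∧t}⟧}(u) |S_{tⱼ₊₁∧t} - u|`, where `⦅a,b⟧ = (a ∧ b, a ∨ b]`.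
For a partition without finite accumulation points only finitely many terms are nonzero. -/
def discreteLocalTime (S : PricePath) (π : ℕ → WithTop ℝ≥0) (t : ℝ≥0) (u : ℝ) : ℝ :=
  ∑' j : ℕ, (Set.uIoc (valueAtMin S (π j) t) (valueAtMin S (π (j + 1)) t)).indicator
    (fun v => |valueAtMin S (π (j + 1)) t - v|) u

/-- The supremum norm on `[0,T] × ℝ`, with values in `[0,∞]`. -/
def supNorm (T : ℝ≥0) (f : ℝ≥0 → ℝ → ℝ) : ℝ≥0∞ :=
  ⨆ t ∈ Set.Icc 0 T, ⨆ u : ℝ, ‖f t u‖ₑ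

/-- The norm `‖f‖_∞ + [f]_α` of the Hölder space `C^α(ℝ)`, with values in `[0,∞]`. -/
def holderSpaceNorm (α : ℝ≥0) (f : ℝ → ℝ) : ℝ≥0∞ :=
  (⨆ u : ℝ, ‖f u‖ₑ) + eHolderNorm α f

/-- `L ∈ C([0,T], C^α(ℝ))`: every `L_t` lies in `C^α(ℝ)`, and `t ↦ L_t` is continuous on `[0,T]`
for the norm of `C^α(ℝ)`. -/
def IsContinuousIntoHolder (T α : ℝ≥0) (L : ℝ≥0 → ℝ → ℝ) : Prop :=
  (∀ t ∈ Set.Icc 0 T, holderSpaceNorm α (L t) < ∞) ∧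
    ∀ t ∈ Set.Icc 0 T,
      Tendsto (fun s : ℝ≥0 => holderSpaceNorm α (fun u => L s u - L t u))
        (𝓝[Set.Icc 0 T] t) (𝓝 0)

/-- The `p`-variation of `f : ℝ → ℝ` on the whole line, with values in `[0,∞]`. -/
def pVariation (p : ℝ) (f : ℝ → ℝ) : ℝ≥0∞ :=
  ⨆ (N : ℕ) (u : Fin (N + 1) → ℝ) (_ : StrictMono u),
    (∑ k : Fin N, ‖f (u k.succ) - f (u k.castSucc)‖ₑ ^ p) ^ (1 / p)

end

end VovkLocalTime

/-!
The discrete Tanaka formula `discreteLocalTime_lebesguePartition` writes the discrete local time at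
`u` as `(u - S t)⁺ - (u - S 0)⁺` plus the gains of holding the position `1_{S < u}` along the
partition. Bets of size of order `2^{n/2}` on positions attached to the grid points of level `n`,
reinvested multiplicatively and stopped at a large wealth, are admissible. Summed with summable
weights over all levels and grid points they show that, for typical price paths, the gains of these
positions are at most `2^{-n/2}` times the sum of a logarithm of the weight and their quadratic
variation, which counts visits of grid points. The number of visits is in turn bounded by the gains
of `1_{S < u}`, so a Gronwall argument over the levels shows that these gains change by
`O(n 2^{-n/2})` from level to level and between neighbouring grid points. Convergence with a rate,
Hölder regularity and `p`-variation bounds for `p > 2` all follow from this.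
-/

namespace VovkLocalTime

noncomputable section

/-! ### The dyadic Lebesgue partition -/

theorem dyadicGrid_mono {m n : ℕ} (h : m ≤ n) : dyadicGrid m ⊆ dyadicGrid n := by
  rintro x ⟨k, rfl⟩
  refine ⟨k * 2 ^ (n - m), ?_⟩
  have hpow : (2 : ℝ) ^ n = 2 ^ m * 2 ^ (n - m) := by rw [← pow_add, Nat.add_sub_cancel' h]
  rw [hpow]; push_cast; field_simp

theorem countable_dyadicGrid (n : ℕ) : (dyadicGrid n).Countable :=
  (Set.countable_range fun m : ℤ => (m : ℝ) * ((2 : ℝ) ^ n)⁻¹).mono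
    fun _ hx => hx.imp fun _ => Eq.symm

theorem le_abs_sub_of_mem_dyadicGrid {n : ℕ} {x y : ℝ} (hx : x ∈ dyadicGrid n)
    (hy : y ∈ dyadicGrid n) (hxy : x ≠ y) : ((2 : ℝ) ^ n)⁻¹ ≤ |x - y| := by
  obtain ⟨k, rfl⟩ := hx
  obtain ⟨l, rfl⟩ := hy
  have hkl : k - l ≠ 0 := fun h => hxy (by rw [sub_eq_zero.1 h])
  rw [← sub_mul, abs_mul, abs_of_pos (a := ((2 : ℝ) ^ n)⁻¹) (by positivity)]
  exact le_mul_of_one_le_left (by positivity) (by exact_mod_cast Int.one_le_abs hkl)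

theorem isClosed_of_subset_dyadicGrid {n : ℕ} {s : Set ℝ} (hs : s ⊆ dyadicGrid n) :
    IsClosed s :=
  Metric.isClosed_of_pairwise_le_dist (ε := ((2 : ℝ) ^ n)⁻¹) (by positivity)
    fun _ hx _ hy hxy => le_abs_sub_of_mem_dyadicGrid (hs hx) (hs hy) hxy

theorem exists_mem_dyadicGrid_Ioc (n : ℕ) (c : ℝ) :
    ∃ d ∈ dyadicGrid n, d ∈ Set.Ioc c (c + ((2 : ℝ) ^ n)⁻¹) := by
  have hpos : (0 : ℝ) < 2 ^ n := by positivity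
  refine ⟨_, ⟨⌊c * 2 ^ n⌋ + 1, rfl⟩, ?_, ?_⟩
  · rw [← div_eq_mul_inv, lt_div_iff₀ hpos]
    push_cast
    exact Int.lt_floor_add_one _
  · rw [← div_eq_mul_inv, div_le_iff₀ hpos, add_mul, inv_mul_cancel₀ hpos.ne']
    push_cast
    gcongr
    exact Int.floor_le _

theorem exists_mem_dyadicGrid_Ico (n : ℕ) (c : ℝ) :
    ∃ d ∈ dyadicGrid n, d ∈ Set.Ico (c - ((2 : ℝ) ^ n)⁻¹) c := by
  obtain ⟨_, ⟨m, rfl⟩, hlt, hle⟩ := exists_mem_dyadicGrid_Ioc n (-c)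
  refine ⟨_, ⟨-m, rfl⟩, ?_, ?_⟩ <;> push_cast <;> linarith

/-- The value `S_{τⁿₖ}` of the path at a partition point. If `τⁿₖ = ∞` this is a junk value. -/
def skeleton (S : PricePath) (n k : ℕ) : ℝ := S (lebesguePartition S n k).untopA

section Partition

variable {S : PricePath} {n k : ℕ} {t : ℝ≥0}

theorem skeleton_eq (h : lebesguePartition S n k = t) : skeleton S n k = S t := by
  rw [skeleton, h]; rfl

theorem lebesguePartition_zero (S : PricePath) (n : ℕ) : lebesguePartition S n 0 = 0 := rfl

theorem skeleton_zero (S : PricePath) (n : ℕ) : skeleton S n 0 = S 0 := rfl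

theorem isClosed_setOf_lebesguePartition_le (S : PricePath) (n k : ℕ) :
    IsClosed {t : ℝ≥0 | lebesguePartition S n k ≤ t ∧ S t ∈ dyadicGrid n \ {skeleton S n k}} :=
  (isClosed_Ici.preimage WithTop.continuous_coe).inter
    ((isClosed_of_subset_dyadicGrid Set.sdiff_subset).preimage S.continuous)

theorem lebesguePartition_succ_le_iff (S : PricePath) (n k : ℕ) (t : ℝ≥0) :
    lebesguePartition S n (k + 1) ≤ t ↔
      ∃ s ≤ t, lebesguePartition S n k ≤ s ∧ S s ∈ dyadicGrid n \ {skeleton S n k} := by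
  have hclosed := isClosed_setOf_lebesguePartition_le S n k
  set A := {t : ℝ≥0 | lebesguePartition S n k ≤ t ∧ S t ∈ dyadicGrid n \ {skeleton S n k}}
  have hdef : lebesguePartition S n (k + 1) = sInf ((fun t : ℝ≥0 => (t : WithTop ℝ≥0)) '' A) := rfl
  rcases A.eq_empty_or_nonempty with hA | hA
  · rw [hdef, hA, Set.image_empty, WithTop.sInf_empty]
    refine iff_of_false (not_le.2 (WithTop.coe_lt_top t)) ?_
    rintro ⟨s, -, hs⟩
    exact (Set.eq_empty_iff_forall_notMem.1 hA) s hs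
  · rw [hdef, ← WithTop.coe_sInf' hA (OrderBot.bddBelow A), WithTop.coe_le_coe]
    constructor
    · exact fun h => ⟨sInf A, h, hclosed.csInf_mem hA (OrderBot.bddBelow A)⟩
    · rintro ⟨s, hst, hs⟩
      exact (csInf_le (OrderBot.bddBelow A) hs).trans hst

theorem mem_of_lebesguePartition_succ_eq (h : lebesguePartition S n (k + 1) = t) :
    lebesguePartition S n k ≤ t ∧ S t ∈ dyadicGrid n \ {skeleton S n k} := by
  obtain ⟨s, hst, hs⟩ := (lebesguePartition_succ_le_iff S n k t).1 h.le
  have hts : lebesguePartition S n (k + 1) ≤ s :=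
    (lebesguePartition_succ_le_iff S n k s).2 ⟨s, le_rfl, hs⟩
  rw [h, WithTop.coe_le_coe] at hts
  rwa [le_antisymm hst hts] at hs

theorem lebesguePartition_mono (S : PricePath) (n : ℕ) : Monotone (lebesguePartition S n) := by
  refine monotone_nat_of_le_succ fun k => ?_
  rcases h : lebesguePartition S n (k + 1) with _ | t
  · exact le_top
  · exact (mem_of_lebesguePartition_succ_eq h).1

theorem lebesguePartition_le_succ (S : PricePath) (n k : ℕ) :
    lebesguePartition S n k ≤ lebesguePartition S n (k + 1) :=
  lebesguePartition_mono S n k.le_succ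

theorem skeleton_succ_mem_diff (h : lebesguePartition S n (k + 1) ≠ ⊤) :
    skeleton S n (k + 1) ∈ dyadicGrid n \ {skeleton S n k} := by
  obtain ⟨t, ht⟩ := WithTop.ne_top_iff_exists.1 h
  rw [skeleton_eq ht.symm]
  exact (mem_of_lebesguePartition_succ_eq ht.symm).2

theorem skeleton_succ_mem (h : lebesguePartition S n (k + 1) ≠ ⊤) :
    skeleton S n (k + 1) ∈ dyadicGrid n :=
  (skeleton_succ_mem_diff h).1

theorem skeleton_succ_ne (h : lebesguePartition S n (k + 1) ≠ ⊤) :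
    skeleton S n (k + 1) ≠ skeleton S n k :=
  (skeleton_succ_mem_diff h).2

theorem lebesguePartition_lt_succ (S : PricePath) (n k : ℕ) (h : lebesguePartition S n k ≠ ⊤) :
    lebesguePartition S n k < lebesguePartition S n (k + 1) := by
  refine (lebesguePartition_le_succ S n k).lt_of_ne fun heq => ?_
  refine skeleton_succ_ne (S := S) (n := n) (k := k) (heq ▸ h) ?_
  rw [skeleton, skeleton, heq]

theorem abs_sub_skeleton_le (h₁ : lebesguePartition S n k ≤ t)
    (h₂ : t ≤ lebesguePartition S n (k + 1)) :
    |S t - skeleton S n k| ≤ ((2 : ℝ) ^ n)⁻¹ := by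
  obtain ⟨r, hr⟩ := WithTop.ne_top_iff_exists.1 (ne_top_of_le_ne_top WithTop.coe_ne_top h₁)
  -- By the intermediate value theorem a grid point passed before `t` is a new partition point.
  have eq_of_mem_uIcc : ∀ d ∈ dyadicGrid n, d ≠ skeleton S n k →
      d ∈ Set.uIcc (skeleton S n k) (S t) → S t = d := by
    intro d hd hne hmem
    rw [skeleton_eq hr.symm] at hmem
    obtain ⟨s, hs, rfl⟩ := intermediate_value_uIcc S.continuous.continuousOn hmem
    rw [← hr, WithTop.coe_le_coe] at h₁
    rw [Set.uIcc_of_le h₁] at hs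
    have hle : lebesguePartition S n (k + 1) ≤ s :=
      (lebesguePartition_succ_le_iff S n k s).2
        ⟨s, le_rfl, hr ▸ WithTop.coe_le_coe.2 hs.1, hd, hne⟩
    rw [le_antisymm hs.2 (WithTop.coe_le_coe.1 (h₂.trans hle))]
  rw [abs_le, neg_le_sub_iff_le_add, sub_le_iff_le_add']
  constructor <;> by_contra! hlt
  · obtain ⟨d, hd, hle, hdc⟩ := exists_mem_dyadicGrid_Ico n (skeleton S n k)
    have := eq_of_mem_uIcc d hd hdc.ne (Set.mem_uIcc_of_ge (by linarith) hdc.le)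
    linarith
  · obtain ⟨d, hd, hcd, hle⟩ := exists_mem_dyadicGrid_Ioc n (skeleton S n k)
    have := eq_of_mem_uIcc d hd hcd.ne' (Set.mem_uIcc_of_le hcd.le (by linarith))
    linarith

theorem finite_lebesguePartition_le (S : PricePath) (n : ℕ) (T : ℝ≥0) :
    {k : ℕ | lebesguePartition S n k ≤ T}.Finite := by
  by_contra hinf
  have hle : ∀ k, lebesguePartition S n k ≤ T := by
    intro k
    obtain ⟨l, hl, hkl⟩ := Set.Infinite.exists_gt hinf k
    exact (lebesguePartition_mono S n hkl.le).trans hl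
  have hne : ∀ k, lebesguePartition S n k ≠ ⊤ := fun k =>
    ne_top_of_le_ne_top WithTop.coe_ne_top (hle k)
  choose σ hσ using fun k => WithTop.ne_top_iff_exists.1 (hne k)
  have hmono : Monotone σ := fun a b hab => by
    rw [← WithTop.coe_le_coe, hσ, hσ]; exact lebesguePartition_mono S n hab
  have hbdd : BddAbove (Set.range σ) := ⟨T, by
    rintro _ ⟨k, rfl⟩
    rw [← WithTop.coe_le_coe, hσ]; exact hle k⟩
  have hlim : Tendsto (fun k => skeleton S n k) atTop (𝓝 (S (⨆ k, σ k))) := by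
    simp only [fun k => skeleton_eq (hσ k).symm]
    exact (S.continuous.tendsto _).comp (tendsto_atTop_ciSup hmono hbdd)
  have hincr : Tendsto (fun k => |skeleton S n (k + 2) - skeleton S n (k + 1)|) atTop (𝓝 0) := by
    simpa using
      ((hlim.comp (tendsto_add_atTop_nat 2)).sub (hlim.comp (tendsto_add_atTop_nat 1))).abs
  obtain ⟨k, hk⟩ := (hincr.eventually_lt_const (u := ((2 : ℝ) ^ n)⁻¹) (by positivity)).exists
  exact hk.not_ge (le_abs_sub_of_mem_dyadicGrid (skeleton_succ_mem (hne _))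
    (skeleton_succ_mem (hne _)) (skeleton_succ_ne (hne _)))

theorem exists_lebesguePartition_le_lt (S : PricePath) (n : ℕ) (t : ℝ≥0) :
    ∃ J, lebesguePartition S n J ≤ t ∧ t < lebesguePartition S n (J + 1) := by
  obtain ⟨J, hJ, hmax⟩ := Set.exists_max_image _ id (finite_lebesguePartition_le S n t)
    ⟨0, (lebesguePartition_zero S n).trans_le bot_le⟩
  exact ⟨J, hJ, not_le.1 fun h => (hmax _ h).not_gt J.lt_succ_self⟩

end Partition

/-! ### Gains along a partition -/

section Gains

variable {S : PricePath} {n : ℕ} {t : ℝ≥0}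

theorem valueAtMin_of_le {τ : WithTop ℝ≥0} (h : τ ≤ t) : valueAtMin S τ t = S τ.untopA := by
  rw [valueAtMin, min_eq_right h]

theorem valueAtMin_of_ge {τ : WithTop ℝ≥0} (h : t ≤ τ) : valueAtMin S τ t = S t := by
  rw [valueAtMin, min_eq_left h]; rfl

theorem tsum_valueAtMin_eq_sum {M : Type*} [AddCommMonoid M] [TopologicalSpace M]
    {π : ℕ → WithTop ℝ≥0} (hπ : Monotone π) {J : ℕ} (h : t ≤ π J)
    (f : ℕ → ℝ → ℝ → M) (hf : ∀ k x, f k x x = 0) :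
    ∑' k, f k (valueAtMin S (π k) t) (valueAtMin S (π (k + 1)) t) =
      ∑ k ∈ Finset.range J, f k (valueAtMin S (π k) t) (valueAtMin S (π (k + 1)) t) := by
  refine tsum_eq_sum fun k hk => ?_
  have hk : t ≤ π k := h.trans (hπ (not_lt.1 fun hlt => hk (Finset.mem_range.2 hlt)))
  rw [valueAtMin_of_ge hk, valueAtMin_of_ge (hk.trans (hπ k.le_succ)), hf]

theorem tsum_valueAtMin_eq_sum_add {M : Type*} [AddCommMonoid M] [TopologicalSpace M]
    {π : ℕ → WithTop ℝ≥0} (hπ : Monotone π) {J : ℕ} (h₁ : π J ≤ t) (h₂ : t ≤ π (J + 1))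
    (f : ℕ → ℝ → ℝ → M) (hf : ∀ k x, f k x x = 0) :
    ∑' k, f k (valueAtMin S (π k) t) (valueAtMin S (π (k + 1)) t) =
      ∑ k ∈ Finset.range J, f k (S (π k).untopA) (S (π (k + 1)).untopA) +
        f J (S (π J).untopA) (S t) := by
  have hle {k : ℕ} (hk : k ≤ J) : valueAtMin S (π k) t = S (π k).untopA :=
    valueAtMin_of_le ((hπ hk).trans h₁)
  rw [tsum_valueAtMin_eq_sum hπ h₂ f hf, Finset.sum_range_succ, valueAtMin_of_ge h₂, hle le_rfl]
  congr 1
  refine Finset.sum_congr rfl fun k hk => ?_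
  have hk : k < J := Finset.mem_range.1 hk
  rw [hle hk, hle hk.le]

/-- The gains up to time `t` of holding the position `F k` on the `k`-th interval of the dyadic
Lebesgue partition of level `n`. -/
def levelGain (S : PricePath) (n : ℕ) (F : ℕ → ℝ) (t : ℝ≥0) : ℝ :=
  ∑' k : ℕ, F k * (valueAtMin S (lebesguePartition S n (k + 1)) t -
    valueAtMin S (lebesguePartition S n k) t)

theorem levelGain_eq {J : ℕ} (h₁ : lebesguePartition S n J ≤ t)
    (h₂ : t ≤ lebesguePartition S n (J + 1)) (F : ℕ → ℝ) :
    levelGain S n F t =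
      ∑ k ∈ Finset.range J, F k * (skeleton S n (k + 1) - skeleton S n k) +
        F J * (S t - skeleton S n J) :=
  tsum_valueAtMin_eq_sum_add (lebesguePartition_mono S n) h₁ h₂ (fun k x y => F k * (y - x))
    (by simp)

theorem levelGain_add (S : PricePath) (n : ℕ) (F G : ℕ → ℝ) (t : ℝ≥0) :
    levelGain S n (F + G) t = levelGain S n F t + levelGain S n G t := by
  obtain ⟨J, h₁, h₂⟩ := exists_lebesguePartition_le_lt S n t
  simp only [levelGain_eq h₁ h₂.le, Pi.add_apply, add_mul, Finset.sum_add_distrib]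
  ring

theorem levelGain_smul (S : PricePath) (n : ℕ) (c : ℝ) (F : ℕ → ℝ) (t : ℝ≥0) :
    levelGain S n (c • F) t = c * levelGain S n F t := by
  obtain ⟨J, h₁, h₂⟩ := exists_lebesguePartition_le_lt S n t
  simp only [levelGain_eq h₁ h₂.le, Pi.smul_apply, smul_eq_mul, mul_add, Finset.mul_sum, mul_assoc]

theorem levelGain_sub (S : PricePath) (n : ℕ) (F G : ℕ → ℝ) (t : ℝ≥0) :
    levelGain S n (F - G) t = levelGain S n F t - levelGain S n G t := by
  rw [sub_eq_add_neg, ← neg_one_smul ℝ G, levelGain_add, levelGain_smul, neg_one_mul,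
    sub_eq_add_neg]

end Gains

/-! ### Refinement of the dyadic Lebesgue partition -/

/-- The index of the interval of the partition of level `n` that contains the `l`-th point of the
finer partition of level `N`. -/
def coarseIndex (S : PricePath) (n N : ℕ) : ℕ → ℕ
  | 0 => 0
  | l + 1 => if lebesguePartition S n (coarseIndex S n N l + 1) ≤ lebesguePartition S N (l + 1)
      then coarseIndex S n N l + 1 else coarseIndex S n N l

theorem coarseIndex_le (S : PricePath) (n N l : ℕ) : coarseIndex S n N l ≤ l := by
  induction l with
  | zero => exact le_rfl
  | succ l ih => rw [coarseIndex]; split_ifs <;> omega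

section Refinement

variable {S : PricePath} {n N : ℕ}

theorem lebesguePartition_succ_le_of_lt {j l : ℕ} (hnN : n ≤ N)
    (h₁ : lebesguePartition S n j ≤ lebesguePartition S N l)
    (h₂ : lebesguePartition S N l < lebesguePartition S n (j + 1)) :
    lebesguePartition S N (l + 1) ≤ lebesguePartition S n (j + 1) := by
  by_cases htop : lebesguePartition S n (j + 1) = ⊤
  · exact htop ▸ le_top
  obtain ⟨s, hs⟩ := WithTop.ne_top_iff_exists.1 htop
  obtain ⟨r, hr⟩ := WithTop.ne_top_iff_exists.1 h₂.ne_top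
  obtain ⟨-, hgrid, hne⟩ := mem_of_lebesguePartition_succ_eq hs.symm
  rw [← hs]
  refine (lebesguePartition_succ_le_iff S N l s).2
    ⟨s, le_rfl, h₂.le.trans hs.ge, dyadicGrid_mono hnN hgrid, fun heq => ?_⟩
  have heq : S s = S r := heq.trans (skeleton_eq hr.symm)
  have hle : lebesguePartition S n (j + 1) ≤ r :=
    (lebesguePartition_succ_le_iff S n j r).2 ⟨r, le_rfl, hr ▸ h₁, heq ▸ hgrid, heq ▸ hne⟩
  exact h₂.not_ge (hr ▸ hle)

theorem coarseIndex_spec (hnN : n ≤ N) {l : ℕ} (hl : lebesguePartition S N l ≠ ⊤) :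
    lebesguePartition S n (coarseIndex S n N l) ≤ lebesguePartition S N l ∧
      lebesguePartition S N l < lebesguePartition S n (coarseIndex S n N l + 1) := by
  induction l with
  | zero => exact ⟨le_rfl, lebesguePartition_lt_succ S n 0 hl⟩
  | succ l ih =>
    obtain ⟨h₁, h₂⟩ := ih (ne_top_of_le_ne_top hl (lebesguePartition_le_succ S N l))
    rw [coarseIndex]
    split_ifs with h
    · have heq := h.antisymm (lebesguePartition_succ_le_of_lt hnN h₁ h₂)
      exact ⟨h, heq ▸ lebesguePartition_lt_succ S n _ (heq ▸ hl)⟩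
    · exact ⟨h₁.trans (lebesguePartition_le_succ S N l), not_le.1 h⟩

theorem sum_coarseIndex (hnN : n ≤ N) (F : ℕ → ℝ) {L : ℕ} (hL : lebesguePartition S N L ≠ ⊤) :
    ∑ l ∈ Finset.range L, F (coarseIndex S n N l) * (skeleton S N (l + 1) - skeleton S N l) =
      ∑ j ∈ Finset.range (coarseIndex S n N L), F j * (skeleton S n (j + 1) - skeleton S n j) +
        F (coarseIndex S n N L) * (skeleton S N L - skeleton S n (coarseIndex S n N L)) := by
  induction L with
  | zero => simp [coarseIndex, skeleton_zero]
  | succ L ih =>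
    have hL' := ne_top_of_le_ne_top hL (lebesguePartition_le_succ S N L)
    obtain ⟨h₁, h₂⟩ := coarseIndex_spec hnN hL'
    rw [Finset.sum_range_succ, ih hL', coarseIndex]
    split_ifs with h
    · have hskel : skeleton S n (coarseIndex S n N L + 1) = skeleton S N (L + 1) := by
        rw [skeleton, skeleton, h.antisymm (lebesguePartition_succ_le_of_lt hnN h₁ h₂)]
      rw [Finset.sum_range_succ, hskel]; ring
    · ring

theorem levelGain_coarseIndex (S : PricePath) (hnN : n ≤ N) (F : ℕ → ℝ) (t : ℝ≥0) :
    levelGain S N (fun l => F (coarseIndex S n N l)) t = levelGain S n F t := by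
  obtain ⟨L, h₁, h₂⟩ := exists_lebesguePartition_le_lt S N t
  have hL := ne_top_of_le_ne_top WithTop.coe_ne_top h₁
  obtain ⟨hle, hlt⟩ := coarseIndex_spec hnN hL
  have h₃ : t ≤ lebesguePartition S n (coarseIndex S n N L + 1) :=
    h₂.le.trans (lebesguePartition_succ_le_of_lt hnN hle hlt)
  rw [levelGain_eq h₁ h₂.le, sum_coarseIndex hnN F hL, levelGain_eq (hle.trans h₁) h₃]
  ring

end Refinement

/-! ### Measurability -/

theorem isStronglyProgressive_eval :
    IsStronglyProgressive pathFiltration (fun t (ω : PricePath) => ω t) := by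
  refine StronglyAdapted.isStronglyProgressive_of_continuous (fun t => ?_) fun ω => ω.continuous
  have hcomap : MeasurableSpace.comap (fun ω : PricePath => ω t) (borel ℝ) ≤ pathFiltration t :=
    le_iSup₂ (f := fun (s : ℝ≥0) (_ : s ≤ t) =>
      MeasurableSpace.comap (fun ω : PricePath => ω s) (borel ℝ)) t le_rfl
  exact ((comap_measurable (m := borel ℝ) _).mono hcomap
    (BorelSpace.measurable_eq (α := ℝ)).le).stronglyMeasurable

theorem measurable_valueAtMin {τ : PricePath → WithTop ℝ≥0}
    (hτ : IsStoppingTime pathFiltration τ) (t : ℝ≥0) :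
    Measurable[pathFiltration t] fun ω => valueAtMin ω (τ ω) t :=
  (isStronglyProgressive_eval.stronglyAdapted_stoppedProcess hτ t).measurable

theorem exists_mem_isClosed_iff_forall_exists_dist_lt {X E ι : Type*} [TopologicalSpace X]
    [CompactSpace X] [PseudoMetricSpace E] {q : ι → X} (hq : DenseRange q) {g : X → E}
    (hg : Continuous g) {D : Set E} (hD : IsClosed D) :
    (∃ x, g x ∈ D) ↔ ∀ m : ℕ, ∃ i, ∃ d ∈ D, dist (g (q i)) d < 1 / (m + 1 : ℝ) := by
  constructor
  · rintro ⟨x, hx⟩ m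
    have hopen : IsOpen {y | dist (g y) (g x) < 1 / (m + 1 : ℝ)} :=
      isOpen_lt (by fun_prop) continuous_const
    obtain ⟨i, hi⟩ := hq.exists_mem_open hopen
      ⟨x, by rw [Set.mem_ofPred_eq, dist_self]; positivity⟩
    exact ⟨i, g x, hx, hi⟩
  · intro h
    by_contra! hnot
    have hdisj : Disjoint (Set.range g) D :=
      Set.disjoint_left.2 (Set.forall_mem_range.2 hnot)
    obtain ⟨δ, hδ, hthick⟩ := hdisj.exists_thickenings (isCompact_range hg) hD
    obtain ⟨m, hm⟩ := exists_nat_one_div_lt hδ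
    obtain ⟨i, d, hd, hdist⟩ := h m
    refine Set.disjoint_left.1 hthick (Metric.mem_thickening_iff.2 ⟨_, ⟨q i, rfl⟩, ?_⟩)
      (Metric.self_subset_thickening hδ D hd)
    rw [dist_comm]
    exact hdist.trans hm

theorem lebesguePartition_succ_le_iff_forall (S : PricePath) (n k : ℕ) (t : ℝ≥0) :
    lebesguePartition S n (k + 1) ≤ t ↔
      lebesguePartition S n k ≤ t ∧ ∀ m : ℕ, ∃ i : ℕ, ∃ d ∈ dyadicGrid n,
        d ≠ valueAtMin S (lebesguePartition S n k) t ∧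
        |valueAtMin S (max (lebesguePartition S n k)
          (TopologicalSpace.denseSeq ℝ≥0 i : ℝ≥0)) t - d| < 1 / (m + 1 : ℝ) := by
  by_cases hkt : lebesguePartition S n k ≤ t
  swap
  · exact iff_of_false (fun h => hkt ((lebesguePartition_le_succ S n k).trans h))
      fun h => hkt h.1
  obtain ⟨r, hr⟩ := WithTop.ne_top_iff_exists.1 (ne_top_of_le_ne_top WithTop.coe_ne_top hkt)
  have hrt : r ≤ t := by rwa [← hr, WithTop.coe_le_coe] at hkt
  have hval : ∀ q : ℝ≥0, valueAtMin S (max (lebesguePartition S n k) q) t =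
      S (Set.projIcc r t hrt q) := fun q => by
    rw [Set.coe_projIcc, max_min_distrib_left, max_eq_right hrt, valueAtMin, ← hr]; rfl
  have hq : DenseRange (Set.projIcc r t hrt ∘ TopologicalSpace.denseSeq ℝ≥0) :=
    (Set.projIcc_surjective hrt).denseRange.comp (TopologicalSpace.denseRange_denseSeq ℝ≥0)
      continuous_projIcc
  have hiff := exists_mem_isClosed_iff_forall_exists_dist_lt hq
    (S.continuous.comp continuous_subtype_val)
    (isClosed_of_subset_dyadicGrid (n := n) (Set.sdiff_subset (t := {skeleton S n k})))
  have hvisit : lebesguePartition S n (k + 1) ≤ t ↔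
      ∃ s : Set.Icc r t, S s ∈ dyadicGrid n \ {skeleton S n k} := by
    simp only [lebesguePartition_succ_le_iff, ← hr, WithTop.coe_le_coe, Subtype.exists,
      Set.mem_Icc, exists_prop]
    exact exists_congr fun s => by tauto
  rw [valueAtMin_of_le hkt, ← skeleton, and_iff_right hkt, hvisit]
  simpa only [hval, Set.mem_sdiff, Set.mem_singleton_iff, Function.comp_apply, Real.dist_eq,
    and_assoc] using hiff

theorem isStoppingTime_lebesguePartition (n k : ℕ) :
    IsStoppingTime pathFiltration fun ω => lebesguePartition ω n k := by
  induction k with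
  | zero => exact isStoppingTime_const pathFiltration (0 : ℝ≥0)
  | succ k ih =>
    intro t
    have hset : {ω : PricePath | lebesguePartition ω n (k + 1) ≤ t} =
        {ω : PricePath | lebesguePartition ω n k ≤ t} ∩
        ⋂ m : ℕ, ⋃ i : ℕ, ⋃ d ∈ dyadicGrid n,
          ((fun ω : PricePath => valueAtMin ω (lebesguePartition ω n k) t) ⁻¹' {d}ᶜ ∩
          (fun ω : PricePath => valueAtMin ω (max (lebesguePartition ω n k)
            (TopologicalSpace.denseSeq ℝ≥0 i : ℝ≥0)) t) ⁻¹' {x | |x - d| < 1 / (m + 1 : ℝ)}) := by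
      ext ω
      simp only [lebesguePartition_succ_le_iff_forall, Set.mem_inter_iff, Set.mem_iInter,
        Set.mem_iUnion, Set.mem_ofPred_eq, Set.mem_preimage, Set.mem_compl_singleton_iff,
        exists_prop, ne_comm]
    rw [hset]
    refine (ih t).inter (MeasurableSet.iInter fun m => MeasurableSet.iUnion fun i =>
      MeasurableSet.biUnion (countable_dyadicGrid n) fun d _ => MeasurableSet.inter ?_ ?_)
    · exact measurable_valueAtMin ih t (measurableSet_singleton d).compl
    · have hopen : IsOpen {x : ℝ | |x - d| < 1 / (m + 1 : ℝ)} :=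
        isOpen_lt (by fun_prop) continuous_const
      exact measurable_valueAtMin (ih.max_const _) t hopen.measurableSet

theorem measurable_skeleton {n k l : ℕ} (hlk : l ≤ k) :
    Measurable[(isStoppingTime_lebesguePartition n k).measurableSpace]
      fun ω => skeleton ω n l :=
  (measurable_stoppedValue isStronglyProgressive_eval
    (isStoppingTime_lebesguePartition n l)).mono
    (IsStoppingTime.measurableSpace_mono _ _ fun ω => lebesguePartition_mono ω n hlk) le_rfl

/-! ### Strategies along the dyadic Lebesgue partitions -/

/-- `F` is a sequence of bounded positions, to be held on the successive intervals of the dyadic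
Lebesgue partition of level `n`: the `k`-th one is known at the `k`-th partition point. -/
structure IsLevelStrategy (n : ℕ) (F : ℕ → PricePath → ℝ) : Prop where
  measurable : ∀ k, Measurable[(isStoppingTime_lebesguePartition n k).measurableSpace] (F k)
  bounded : ∀ k, ∃ C : ℝ, ∀ ω, |F k ω| ≤ C

namespace IsLevelStrategy

variable {n N : ℕ} {F G : ℕ → PricePath → ℝ}

theorem zero (n : ℕ) : IsLevelStrategy n 0 :=
  ⟨fun _ => measurable_const, fun _ => ⟨0, fun _ => by simp⟩⟩

theorem add (hF : IsLevelStrategy n F) (hG : IsLevelStrategy n G) : IsLevelStrategy n (F + G) := by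
  refine ⟨fun k => (hF.measurable k).add (hG.measurable k), fun k => ?_⟩
  obtain ⟨C, hC⟩ := hF.bounded k
  obtain ⟨D, hD⟩ := hG.bounded k
  exact ⟨C + D, fun ω => (abs_add_le _ _).trans (add_le_add (hC ω) (hD ω))⟩

theorem smul (c : ℝ) (hF : IsLevelStrategy n F) : IsLevelStrategy n (c • F) := by
  refine ⟨fun k => (hF.measurable k).const_smul c, fun k => ?_⟩
  obtain ⟨C, hC⟩ := hF.bounded k
  refine ⟨|c| * C, fun ω => ?_⟩
  simp only [Pi.smul_apply, smul_eq_mul, abs_mul]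
  exact mul_le_mul_of_nonneg_left (hC ω) (abs_nonneg c)

/-- The simple strategy that holds the position `F k` on the `k`-th partition interval. -/
def toSimple (hF : IsLevelStrategy n F) : SimpleStrategy where
  τ k ω := lebesguePartition ω n k
  isStoppingTime := isStoppingTime_lebesguePartition n
  τ_zero _ := rfl
  τ_mono k ω := lebesguePartition_le_succ ω n k
  τ_strict k ω := lebesguePartition_lt_succ ω n k
  τ_finite ω T := finite_lebesguePartition_le ω n T
  F := F
  F_measurable := hF.measurable
  F_bounded := hF.bounded

theorem integral_toSimple (hF : IsLevelStrategy n F) (t : ℝ≥0) (ω : PricePath) :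
    hF.toSimple.integral t ω = levelGain ω n (fun k => F k ω) t := rfl

end IsLevelStrategy

theorem lebesguePartition_coarseIndex_le (ω : PricePath) {n N : ℕ} (hnN : n ≤ N) (l : ℕ) :
    lebesguePartition ω n (coarseIndex ω n N l) ≤ lebesguePartition ω N l := by
  by_cases h : lebesguePartition ω N l = ⊤
  · exact h ▸ le_top
  · exact (coarseIndex_spec hnN h).1

theorem measurableSet_coarseIndex_eq (n N l j : ℕ) :
    MeasurableSet[(isStoppingTime_lebesguePartition N l).measurableSpace]
      {ω | coarseIndex ω n N l = j} := by
  induction l generalizing j with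
  | zero => simp only [coarseIndex]; exact MeasurableSet.const _
  | succ l ih =>
    have hle := IsStoppingTime.measurableSpace_mono (isStoppingTime_lebesguePartition N l)
      (isStoppingTime_lebesguePartition N (l + 1)) fun ω => lebesguePartition_le_succ ω N l
    have hset : ∀ i, MeasurableSet[(isStoppingTime_lebesguePartition N (l + 1)).measurableSpace]
        {ω | lebesguePartition ω n (i + 1) ≤ lebesguePartition ω N (l + 1)} := fun i =>
      IsStoppingTime.measurableSet_stopping_time_le (isStoppingTime_lebesguePartition n (i + 1)) _
    have hunion : {ω | coarseIndex ω n N (l + 1) = j} =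
        ⋃ i : ℕ, {ω | coarseIndex ω n N l = i} ∩
          (({ω | lebesguePartition ω n (i + 1) ≤ lebesguePartition ω N (l + 1)} ∩
            {_ω | i + 1 = j}) ∪
          ({ω | lebesguePartition ω n (i + 1) ≤ lebesguePartition ω N (l + 1)}ᶜ ∩
            {_ω | i = j})) := by
      ext ω
      simp only [coarseIndex, Set.mem_ofPred_eq, Set.mem_iUnion, Set.mem_inter_iff, Set.mem_union,
        Set.mem_compl_iff, exists_eq_left']
      split_ifs with h <;> simp [h]
    rw [hunion]
    exact MeasurableSet.iUnion fun i => (hle _ (ih i)).inter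
      (((hset i).inter (MeasurableSet.const _)).union
        ((hset i).compl.inter (MeasurableSet.const _)))

theorem measurable_coarseIndex {n N : ℕ} (hnN : n ≤ N) {F : ℕ → PricePath → ℝ}
    (hF : ∀ k, Measurable[(isStoppingTime_lebesguePartition n k).measurableSpace] (F k)) (l : ℕ) :
    Measurable[(isStoppingTime_lebesguePartition N l).measurableSpace]
      fun ω => F (coarseIndex ω n N l) ω := by
  intro B hB
  have hunion : (fun ω => F (coarseIndex ω n N l) ω) ⁻¹' B =
      ⋃ j : ℕ, {ω | coarseIndex ω n N l = j} ∩
        (F j ⁻¹' B ∩ {ω | lebesguePartition ω n j ≤ lebesguePartition ω N l}) := by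
    ext ω
    simp only [Set.mem_preimage, Set.mem_iUnion, Set.mem_inter_iff, Set.mem_ofPred_eq,
      exists_eq_left']
    exact ⟨fun h => ⟨h, lebesguePartition_coarseIndex_le ω hnN l⟩, fun h => h.1⟩
  rw [hunion]
  refine MeasurableSet.iUnion fun j => (measurableSet_coarseIndex_eq n N l j).inter ?_
  have hmin := IsStoppingTime.measurableSet_inter_le (isStoppingTime_lebesguePartition n j)
    (isStoppingTime_lebesguePartition N l) _ (hF j hB)
  exact ((IsStoppingTime.measurableSet_min_iff (isStoppingTime_lebesguePartition n j)
    (isStoppingTime_lebesguePartition N l) _).1 hmin).2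

theorem IsLevelStrategy.refine {n N : ℕ} {F : ℕ → PricePath → ℝ} (hF : IsLevelStrategy n F)
    (hnN : n ≤ N) : IsLevelStrategy N fun l ω => F (coarseIndex ω n N l) ω := by
  refine ⟨fun l => measurable_coarseIndex hnN hF.measurable l, fun l => ?_⟩
  choose C hC using hF.bounded
  refine ⟨∑ j ∈ Finset.range (l + 1), |C j|, fun ω => ?_⟩
  refine ((hC _ ω).trans (le_abs_self _)).trans ?_
  exact Finset.single_le_sum (f := fun j => |C j|) (fun j _ => abs_nonneg _)
    (Finset.mem_range.2 (Nat.lt_succ_of_le (coarseIndex_le ω n N l)))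

theorem exists_isLevelStrategy_sum {ι : Type*} {N : ι → ℕ} {F : ι → ℕ → PricePath → ℝ}
    (hF : ∀ i, IsLevelStrategy (N i) (F i)) (c : ι → ℝ) {M : ℕ} (s : Finset ι)
    (hM : ∀ i ∈ s, N i ≤ M) :
    ∃ G, IsLevelStrategy M G ∧ ∀ t ω, levelGain ω M (fun k => G k ω) t =
      ∑ i ∈ s, c i * levelGain ω (N i) (fun k => F i k ω) t := by
  classical
  induction s using Finset.induction_on with
  | empty => exact ⟨0, IsLevelStrategy.zero M, fun t ω => by simp [levelGain]⟩
  | insert i s hi ih =>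
    obtain ⟨G, hG, hGt⟩ := ih fun j hj => hM j (Finset.mem_insert_of_mem hj)
    have hNM := hM i (Finset.mem_insert_self i s)
    refine ⟨_, (((hF i).refine hNM).smul (c i)).add hG, fun t ω => ?_⟩
    rw [Finset.sum_insert hi, ← hGt, ← levelGain_coarseIndex ω hNM, ← levelGain_smul,
      ← levelGain_add]
    rfl

theorem exists_simpleStrategy_sum {ι : Type*} {N : ι → ℕ} {F : ι → ℕ → PricePath → ℝ}
    (hF : ∀ i, IsLevelStrategy (N i) (F i)) (c : ι → ℝ) (s : Finset ι) :
    ∃ H : SimpleStrategy, ∀ t ω, H.integral t ω =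
      ∑ i ∈ s, c i * levelGain ω (N i) (fun k => F i k ω) t := by
  obtain ⟨G, hG, hGt⟩ := exists_isLevelStrategy_sum hF c s fun i hi => Finset.le_sup (f := N) hi
  exact ⟨hG.toSimple, fun t ω => by rw [hG.integral_toSimple, hGt]⟩

/-! ### Null sets from superhedging -/

theorem Superhedges.mono {lam : ℝ} {A A' : Set PricePath} (h : Superhedges lam A)
    (hA : A' ⊆ A) : Superhedges lam A' := by
  obtain ⟨H, hadm, hH⟩ := h
  exact ⟨H, hadm, fun ω => (Set.indicator_le_indicator_of_subset hA
    (fun _ => zero_le_one) ω).trans (hH ω)⟩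

theorem ForTypicalPaths.mono {P Q : PricePath → Prop} (hP : ForTypicalPaths P)
    (hPQ : ∀ ω, P ω → Q ω) : ForTypicalPaths Q := by
  refine le_antisymm (le_trans ?_ hP.le) bot_le
  exact iInf₂_mono fun lam _ => iInf_mono' fun h => ⟨h.mono fun ω hω hp => hω (hPQ ω hp), le_rfl⟩

theorem superhedges_of_nonneg {lam : ℝ} {A : Set PricePath} (H : ℕ → SimpleStrategy)
    (hnonneg : ∀ m t ω, 0 ≤ lam + (H m).integral t ω)
    (hA : ∀ ω ∈ A, ∀ᶠ t in atTop, ∀ᶠ m in atTop, 1 ≤ lam + (H m).integral t ω) :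
    Superhedges lam A := by
  refine ⟨H, fun m t ω => by linarith [hnonneg m t ω], fun ω => ?_⟩
  by_cases hω : ω ∈ A
  · rw [Set.indicator_of_mem hω]
    refine le_liminf_of_le (by isBoundedDefault) ((hA ω hω).mono fun t ht => ?_)
    refine le_liminf_of_le (by isBoundedDefault) (ht.mono fun m hm => ?_)
    exact_mod_cast hm
  · rw [Set.indicator_of_notMem hω]
    refine le_liminf_of_le (by isBoundedDefault) (Eventually.of_forall fun t => ?_)
    refine le_liminf_of_le (by isBoundedDefault) (Eventually.of_forall fun m => ?_)
    exact_mod_cast hnonneg m t ω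

theorem forTypicalPaths_of_superhedges {P : PricePath → Prop}
    (h : ∀ ε : ℝ, 0 < ε → Superhedges ε {ω | ¬ P ω}) : ForTypicalPaths P := by
  refine le_antisymm (ENNReal.le_of_forall_pos_le_add fun ε hε _ => ?_) bot_le
  rw [zero_add]
  refine (iInf₂_le (ε : ℝ) hε).trans ((iInf_le _ (h ε hε)).trans ?_)
  rw [ENNReal.ofReal_coe_nnreal]

theorem superhedges_exists_of_levelGain {ι : Type*} [Countable ι] {N : ι → ℕ}
    {F : ι → ℕ → PricePath → ℝ} {c : ι → ℝ} {lam : ℝ} (hF : ∀ i, IsLevelStrategy (N i) (F i))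
    (hadm : ∀ i ω t, -1 ≤ levelGain ω (N i) (fun k => F i k ω) t) (hc : ∀ i, 0 < c i)
    (hsum : Summable c) (hlam : ∑' i, c i ≤ lam) :
    Superhedges lam {ω | ∃ i, ∀ᶠ t in atTop,
      1 ≤ c i * (1 + levelGain ω (N i) (fun k => F i k ω) t)} := by
  obtain ⟨s, hs⟩ := exists_seq_tendsto (atTop : Filter (Finset ι))
  choose H hH using fun m => exists_simpleStrategy_sum hF c (s m)
  have hwealth : ∀ m t ω, ∑ i ∈ s m, c i * (1 + levelGain ω (N i) (fun k => F i k ω) t) ≤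
      lam + (H m).integral t ω := by
    intro m t ω
    simp only [hH, mul_add, mul_one, Finset.sum_add_distrib]
    gcongr
    exact (hsum.sum_le_tsum _ fun i _ => (hc i).le).trans hlam
  have hterm : ∀ i t ω, 0 ≤ c i * (1 + levelGain ω (N i) (fun k => F i k ω) t) := fun i t ω =>
    mul_nonneg (hc i).le (by linarith [hadm i ω t])
  refine superhedges_of_nonneg H
    (fun m t ω => (Finset.sum_nonneg fun i _ => hterm i t ω).trans (hwealth m t ω)) ?_
  rintro ω ⟨i, hi⟩
  filter_upwards [hi] with t ht
  filter_upwards [hs.eventually (eventually_ge_atTop {i})] with m hm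
  calc 1 ≤ c i * (1 + levelGain ω (N i) (fun k => F i k ω) t) := ht
    _ ≤ ∑ i ∈ s m, c i * (1 + levelGain ω (N i) (fun k => F i k ω) t) :=
      Finset.single_le_sum (fun i _ => hterm i t ω) (Finset.singleton_subset_iff.1 hm)
    _ ≤ lam + (H m).integral t ω := hwealth m t ω

/-! ### Multiplicative betting -/

/-- The wealth obtained from unit capital by multiplying with `1 + x k` in round `k`, stopped as
soon as it reaches the level `K`. -/
def stoppedWealth (K : ℝ) (x : ℕ → ℝ) : ℕ → ℝ
  | 0 => 1
  | k + 1 => if K ≤ stoppedWealth K x k then stoppedWealth K x k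
      else stoppedWealth K x k * (1 + x k)

section StoppedWealth

variable {K : ℝ} {x : ℕ → ℝ} {I J : ℕ}

theorem stoppedWealth_nonneg (hx : ∀ k < J, -1 ≤ x k) : 0 ≤ stoppedWealth K x J := by
  induction J with
  | zero => exact zero_le_one
  | succ J ih =>
    have hJ := ih fun k hk => hx k (hk.trans J.lt_succ_self)
    rw [stoppedWealth]
    split_ifs
    · exact hJ
    · exact mul_nonneg hJ (by linarith [hx J J.lt_succ_self])

theorem stoppedWealth_le_two_pow (hx : ∀ k < J, |x k| ≤ 1) : stoppedWealth K x J ≤ 2 ^ J := by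
  induction J with
  | zero => exact (pow_zero _).ge
  | succ J ih =>
    have hJ := ih fun k hk => hx k (hk.trans J.lt_succ_self)
    have hxJ := abs_le.1 (hx J J.lt_succ_self)
    rw [stoppedWealth, pow_succ]
    split_ifs
    · exact hJ.trans (le_mul_of_one_le_right (by positivity) one_le_two)
    · exact mul_le_mul hJ (by linarith) (by linarith) (by positivity)

theorem stoppedWealth_eq_of_le (hI : K ≤ stoppedWealth K x I) (hIJ : I ≤ J) :
    stoppedWealth K x J = stoppedWealth K x I := by
  induction J, hIJ using Nat.le_induction with
  | base => rfl
  | succ J _ ih => rw [stoppedWealth, if_pos (ih ▸ hI), ih]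

theorem exists_le_stoppedWealth (hK : K ≤ ∏ k ∈ Finset.range J, (1 + x k)) :
    ∃ I ≤ J, K ≤ stoppedWealth K x I := by
  by_contra! hlt
  have heq : ∀ I ≤ J, stoppedWealth K x I = ∏ k ∈ Finset.range I, (1 + x k) := by
    intro I hI
    induction I with
    | zero => rfl
    | succ I ih =>
      have hI' : I ≤ J := I.le_succ.trans hI
      rw [stoppedWealth, if_neg (hlt I hI').not_ge, ih hI', Finset.prod_range_succ]
  exact (hlt J le_rfl).not_ge (heq J le_rfl ▸ hK)

theorem le_stoppedWealth (hK : K ≤ ∏ k ∈ Finset.range I, (1 + x k)) (hIJ : I ≤ J) :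
    K ≤ stoppedWealth K x J := by
  obtain ⟨L, hLI, hL⟩ := exists_le_stoppedWealth hK
  exact hL.trans_eq (stoppedWealth_eq_of_le hL (hLI.trans hIJ)).symm

end StoppedWealth

/-- The gain of the position `F` over the `k`-th interval of the dyadic Lebesgue partition of level
`n`. Like `skeleton`, it has a meaning only if that interval is bounded. -/
def stepGain (S : PricePath) (n : ℕ) (F : ℕ → ℝ) (k : ℕ) : ℝ :=
  F k * (skeleton S n (k + 1) - skeleton S n k)

/-- The position whose wealth is the stopped multiplicative wealth of the bets `h`. It vanishes on
`τⁿₖ = ∞`, where the junk values of `skeleton` would make it unbounded. -/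
def bettingPosition (n : ℕ) (K : ℝ) (h : ℕ → PricePath → ℝ) (k : ℕ) (ω : PricePath) : ℝ :=
  if lebesguePartition ω n k = ⊤ ∨ K ≤ stoppedWealth K (stepGain ω n fun l => h l ω) k then 0
  else stoppedWealth K (stepGain ω n fun l => h l ω) k * h k ω

section Betting

variable {n : ℕ} {K : ℝ} {ω : PricePath} {t : ℝ≥0} {J : ℕ}

theorem lebesguePartition_ne_top_of_le {j k : ℕ} (hk : lebesguePartition ω n k ≠ ⊤)
    (hjk : j ≤ k) : lebesguePartition ω n j ≠ ⊤ :=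
  ne_top_of_le_ne_top hk (lebesguePartition_mono ω n hjk)

theorem abs_skeleton_succ_sub_le {k : ℕ} (hk : lebesguePartition ω n (k + 1) ≠ ⊤) :
    |skeleton ω n (k + 1) - skeleton ω n k| ≤ ((2 : ℝ) ^ n)⁻¹ := by
  obtain ⟨t, ht⟩ := WithTop.ne_top_iff_exists.1 hk
  rw [skeleton_eq ht.symm]
  exact abs_sub_skeleton_le (ht ▸ lebesguePartition_le_succ ω n k) ht.le

theorem abs_mul_le_one_of_le_two_pow {a x : ℝ} (ha : |a| ≤ 2 ^ n) (hx : |x| ≤ ((2 : ℝ) ^ n)⁻¹) :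
    |a * x| ≤ 1 := by
  rw [abs_mul, ← mul_inv_cancel₀ (pow_ne_zero n (two_ne_zero (α := ℝ)))]
  gcongr

theorem abs_stepGain_le_one {F : ℕ → ℝ} (hF : ∀ k, |F k| ≤ 2 ^ n)
    (hJ : lebesguePartition ω n J ≠ ⊤) : ∀ k < J, |stepGain ω n F k| ≤ 1 := fun k hk =>
  abs_mul_le_one_of_le_two_pow (hF k)
    (abs_skeleton_succ_sub_le (lebesguePartition_ne_top_of_le hJ hk))

variable {h : ℕ → PricePath → ℝ}

theorem measurable_stoppedWealth (K : ℝ)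
    (hm : ∀ k, Measurable[(isStoppingTime_lebesguePartition n k).measurableSpace] (h k)) (k : ℕ) :
    Measurable[(isStoppingTime_lebesguePartition n k).measurableSpace] fun ω =>
      stoppedWealth K (stepGain ω n fun l => h l ω) k := by
  induction k with
  | zero => exact measurable_const
  | succ k ih =>
    have hle := IsStoppingTime.measurableSpace_mono (isStoppingTime_lebesguePartition n k)
      (isStoppingTime_lebesguePartition n (k + 1)) fun ω => lebesguePartition_le_succ ω n k
    have ih' := ih.mono hle le_rfl
    have hk' := (hm k).mono hle le_rfl
    simp only [stoppedWealth, stepGain]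
    refine Measurable.ite (ih' measurableSet_Ici) ih' (ih'.mul (measurable_const.add (hk'.mul ?_)))
    exact (measurable_skeleton le_rfl).sub (measurable_skeleton k.le_succ)

theorem isLevelStrategy_bettingPosition (K : ℝ)
    (hm : ∀ k, Measurable[(isStoppingTime_lebesguePartition n k).measurableSpace] (h k))
    (hb : ∀ k ω, |h k ω| ≤ 2 ^ n) : IsLevelStrategy n (bettingPosition n K h) := by
  refine ⟨fun k => ?_, fun k => ⟨2 ^ k * 2 ^ n, fun ω => ?_⟩⟩
  · refine Measurable.ite (MeasurableSet.union ?_ ?_) measurable_const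
      ((measurable_stoppedWealth K hm k).mul (hm k))
    · exact (isStoppingTime_lebesguePartition n k).measurable (measurableSet_singleton ⊤)
    · exact (measurable_stoppedWealth K hm k) measurableSet_Ici
  · rw [bettingPosition]
    split_ifs with hif
    · rw [abs_zero]; positivity
    · have hx := abs_stepGain_le_one (fun k => hb k ω) (not_or.1 hif).1
      rw [abs_mul, abs_of_nonneg (stoppedWealth_nonneg fun k hk => (abs_le.1 (hx k hk)).1)]
      exact mul_le_mul (stoppedWealth_le_two_pow hx) (hb k ω) (abs_nonneg _) (by positivity)

theorem levelGain_bettingPosition (h₁ : lebesguePartition ω n J ≤ t)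
    (h₂ : t ≤ lebesguePartition ω n (J + 1)) :
    levelGain ω n (fun k => bettingPosition n K h k ω) t =
      stoppedWealth K (stepGain ω n fun l => h l ω) J - 1 +
        bettingPosition n K h J ω * (ω t - skeleton ω n J) := by
  rw [levelGain_eq h₁ h₂]
  congr 1
  have hJ := ne_top_of_le_ne_top WithTop.coe_ne_top h₁
  clear h₁ h₂
  induction J with
  | zero => simp [stoppedWealth]
  | succ J ih =>
    have hJ' := lebesguePartition_ne_top_of_le hJ J.le_succ
    rw [Finset.sum_range_succ, ih hJ', stoppedWealth, bettingPosition]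
    by_cases hK : K ≤ stoppedWealth K (stepGain ω n fun l => h l ω) J
    · rw [if_pos (Or.inr hK), if_pos hK]; ring
    · rw [if_neg (not_or.2 ⟨hJ', hK⟩), if_neg hK, stepGain]; ring

theorem neg_one_le_levelGain_bettingPosition (K : ℝ) (hb : ∀ k, |h k ω| ≤ 2 ^ n) (t : ℝ≥0) :
    -1 ≤ levelGain ω n (fun k => bettingPosition n K h k ω) t := by
  obtain ⟨J, h₁, h₂⟩ := exists_lebesguePartition_le_lt ω n t
  have hJ := ne_top_of_le_ne_top WithTop.coe_ne_top h₁
  have hwealth : 0 ≤ stoppedWealth K (stepGain ω n fun l => h l ω) J :=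
    stoppedWealth_nonneg fun k hk => (abs_le.1 (abs_stepGain_le_one hb hJ k hk)).1
  rw [levelGain_bettingPosition h₁ h₂.le, bettingPosition]
  split_ifs
  · linarith
  · have hlast := (abs_le.1 (abs_mul_le_one_of_le_two_pow (hb J)
      (abs_sub_skeleton_le h₁ h₂.le))).1
    rw [mul_assoc]
    nlinarith

theorem le_levelGain_bettingPosition
    (hK : K ≤ ∏ k ∈ Finset.range J, (1 + stepGain ω n (fun l => h l ω) k))
    (ht : lebesguePartition ω n J ≤ t) :
    K - 1 ≤ levelGain ω n (fun k => bettingPosition n K h k ω) t := by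
  obtain ⟨L, h₁, h₂⟩ := exists_lebesguePartition_le_lt ω n t
  have hJL : J < L + 1 := (lebesguePartition_mono ω n).reflect_lt (ht.trans_lt h₂)
  have hL : K ≤ stoppedWealth K (stepGain ω n fun l => h l ω) L :=
    le_stoppedWealth hK (Nat.le_of_lt_succ hJL)
  rw [levelGain_bettingPosition h₁ h₂.le, bettingPosition, if_pos (Or.inr hL)]
  linarith

end Betting

theorem forTypicalPaths_bets_bounded {ι : Type*} [Countable ι] {N : ι → ℕ}
    {h : ι → ℕ → PricePath → ℝ} {w : ι → ℝ}
    (hm : ∀ i k, Measurable[(isStoppingTime_lebesguePartition (N i) k).measurableSpace] (h i k))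
    (hb : ∀ i k ω, |h i k ω| ≤ 2 ^ N i) (hw : ∀ i, 0 < w i) (hsum : Summable w) :
    ForTypicalPaths fun ω => ∃ B : ℝ, ∀ i J, lebesguePartition ω (N i) J ≠ ⊤ →
      w i * ∏ k ∈ Finset.range J, (1 + stepGain ω (N i) (fun l => h i l ω) k) ≤ B := by
  have hW : 0 ≤ ∑' i, w i := tsum_nonneg fun i => (hw i).le
  refine forTypicalPaths_of_superhedges fun ε hε => ?_
  set δ := ε / (∑' i, w i + 1)
  have hδ : 0 < δ := by positivity
  have hδw : ∀ i, 0 < δ * w i := fun i => mul_pos hδ (hw i)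
  have hcost : ∑' i, δ * w i ≤ ε := by
    rw [tsum_mul_left, div_mul_eq_mul_div]
    exact div_le_of_le_mul₀ (by positivity) hε.le (by gcongr; linarith)
  refine (superhedges_exists_of_levelGain
    (fun i => isLevelStrategy_bettingPosition (δ * w i)⁻¹ (hm i) (hb i))
    (fun i ω t => neg_one_le_levelGain_bettingPosition (δ * w i)⁻¹ (fun k => hb i k ω) t)
    hδw (hsum.mul_left δ) hcost).mono fun ω hω => ?_
  simp only [Set.mem_ofPred_eq, not_exists, not_forall, not_le] at hω
  obtain ⟨i, J, hJ, hlt⟩ := hω δ⁻¹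
  obtain ⟨t₀, ht₀⟩ := WithTop.ne_top_iff_exists.1 hJ
  refine ⟨i, (eventually_ge_atTop t₀).mono fun t ht => ?_⟩
  have hK : (δ * w i)⁻¹ ≤ ∏ k ∈ Finset.range J, (1 + stepGain ω (N i) (fun l => h i l ω) k) := by
    rw [mul_inv, mul_comm, inv_mul_le_iff₀ (hw i)]
    exact hlt.le
  have hgain := le_levelGain_bettingPosition hK (ht₀ ▸ WithTop.coe_le_coe.2 ht)
  rw [← inv_le_iff_one_le_mul₀' (hδw i)]
  linarith

/-! ### An exponential inequality for typical price paths -/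

theorem sub_two_mul_sq_le_log_one_add {x : ℝ} (hx : |x| ≤ 1 / 2) :
    x - 2 * x ^ 2 ≤ Real.log (1 + x) := by
  have hlog := Real.abs_log_sub_add_sum_range_le (x := -x) (by rw [abs_neg]; linarith) 1
  norm_num at hlog
  have hdiv : x ^ 2 / (1 - |x|) ≤ 2 * x ^ 2 := by
    rw [div_le_iff₀ (by linarith)]
    nlinarith [sq_nonneg x]
  linarith [(abs_le.1 (hlog.trans hdiv)).1]

theorem sum_sub_two_mul_sq_le_of_prod_le_exp {ι : Type*} {s : Finset ι} {x : ι → ℝ} {Λ : ℝ}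
    (hx : ∀ i ∈ s, |x i| ≤ 1 / 2) (hprod : ∏ i ∈ s, (1 + x i) ≤ Real.exp Λ) :
    ∑ i ∈ s, (x i - 2 * x i ^ 2) ≤ Λ := by
  have hpos : ∀ i ∈ s, 0 < 1 + x i := fun i hi => by linarith [(abs_le.1 (hx i hi)).1]
  calc ∑ i ∈ s, (x i - 2 * x i ^ 2) ≤ ∑ i ∈ s, Real.log (1 + x i) :=
        Finset.sum_le_sum fun i hi => sub_two_mul_sq_le_log_one_add (hx i hi)
    _ = Real.log (∏ i ∈ s, (1 + x i)) := (Real.log_prod fun i hi => (hpos i hi).ne').symm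
    _ ≤ Λ := (Real.log_le_iff_le_exp (Finset.prod_pos hpos)).2 hprod

theorem sum_mul_le_of_prod_le_exp {ι : Type*} {s : Finset ι} {q Δ : ι → ℝ} {ρ Λ : ℝ}
    (hρ : 0 < ρ) (hρ1 : ρ ≤ 1) (hq : ∀ i ∈ s, |q i| ≤ 1) (hΔ : ∀ i ∈ s, |Δ i| ≤ ρ ^ 2)
    (hprod : ∏ i ∈ s, (1 + (2 * ρ)⁻¹ * q i * Δ i) ≤ Real.exp Λ) :
    ∑ i ∈ s, q i * Δ i ≤ 2 * ρ * Λ + ρ * (ρ ^ 2 * ∑ i ∈ s, q i ^ 2) := by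
  have hx : ∀ i ∈ s, |(2 * ρ)⁻¹ * q i * Δ i| ≤ ρ / 2 * |q i| := fun i hi =>
    calc |(2 * ρ)⁻¹ * q i * Δ i| = (2 * ρ)⁻¹ * |q i| * |Δ i| := by
          rw [abs_mul, abs_mul, abs_of_pos (by positivity : 0 < (2 * ρ)⁻¹)]
      _ ≤ (2 * ρ)⁻¹ * |q i| * ρ ^ 2 := by gcongr; exact hΔ i hi
      _ = ρ / 2 * |q i| := by field_simp
  have hterm : ∀ i ∈ s, q i * Δ i - ρ * (ρ ^ 2 * q i ^ 2) ≤
      2 * ρ * ((2 * ρ)⁻¹ * q i * Δ i - 2 * ((2 * ρ)⁻¹ * q i * Δ i) ^ 2) := fun i hi => by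
    have hsq : ((2 * ρ)⁻¹ * q i * Δ i) ^ 2 ≤ ρ ^ 2 / 4 * q i ^ 2 := by
      refine (sq_le_sq.2 ((hx i hi).trans (le_abs_self _))).trans_eq ?_
      rw [mul_pow, sq_abs]; ring
    have hlin : 2 * ρ * ((2 * ρ)⁻¹ * q i * Δ i) = q i * Δ i := by field_simp
    nlinarith
  have hsum := Finset.sum_le_sum hterm
  have hle := sum_sub_two_mul_sq_le_of_prod_le_exp
    (fun i hi => (hx i hi).trans (by nlinarith [hq i hi, abs_nonneg (q i)])) hprod
  rw [← Finset.mul_sum, Finset.sum_sub_distrib, ← Finset.mul_sum, ← Finset.mul_sum] at hsum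
  linarith [mul_le_mul_of_nonneg_left hle (by positivity : 0 ≤ 2 * ρ)]

/-- The scale `2^{-n/2}`. -/
def rootScale (n : ℕ) : ℝ := (√2 ^ n)⁻¹

theorem rootScale_pos (n : ℕ) : 0 < rootScale n := by
  rw [rootScale]; positivity

theorem rootScale_sq (n : ℕ) : rootScale n ^ 2 = ((2 : ℝ) ^ n)⁻¹ := by
  rw [rootScale, inv_pow, ← pow_mul, mul_comm, pow_mul, Real.sq_sqrt zero_le_two]

theorem rootScale_le_one (n : ℕ) : rootScale n ≤ 1 :=
  inv_le_one_of_one_le₀ (one_le_pow₀ (Real.one_le_sqrt.2 one_le_two))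

theorem inv_rootScale_le_two_pow (n : ℕ) : (rootScale n)⁻¹ ≤ 2 ^ n := by
  rw [rootScale, inv_inv]
  gcongr
  exact Real.sqrt_le_iff.2 (by norm_num)

/-- The gains of the positions `q` along the partition of level `n` are controlled by `Λ` and the
quadratic variation `2⁻ⁿ ∑ q²` of the gains. -/
def HasGainBound (S : PricePath) (n : ℕ) (q : ℕ → ℝ) (Λ : ℝ) : Prop :=
  ∀ (J : ℕ) (t : ℝ≥0), lebesguePartition S n J ≤ t → t ≤ lebesguePartition S n (J + 1) →
    |levelGain S n q t| ≤ rootScale n ^ 2 + 2 * rootScale n * Λ +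
      rootScale n * (((2 : ℝ) ^ n)⁻¹ * ∑ l ∈ Finset.range J, q l ^ 2)

theorem hasGainBound_of_prod_le_exp {S : PricePath} {n : ℕ} {q : ℕ → ℝ} {Λ : ℝ}
    (hq : ∀ k, |q k| ≤ 1)
    (hprod : ∀ (ε : ℤˣ) J, lebesguePartition S n J ≠ ⊤ → ∏ k ∈ Finset.range J,
      (1 + stepGain S n (fun l => (2 * rootScale n)⁻¹ * ((ε : ℤ) * q l)) k) ≤ Real.exp Λ) :
    HasGainBound S n q Λ := by
  intro J t h₁ h₂
  have hJ := ne_top_of_le_ne_top WithTop.coe_ne_top h₁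
  have hstep : ∀ k ∈ Finset.range J, |skeleton S n (k + 1) - skeleton S n k| ≤ rootScale n ^ 2 :=
    fun k hk => rootScale_sq n ▸
      abs_skeleton_succ_sub_le (lebesguePartition_ne_top_of_le hJ (Finset.mem_range.1 hk))
  have hlast : |q J * (S t - skeleton S n J)| ≤ rootScale n ^ 2 := by
    rw [abs_mul, rootScale_sq]
    exact (mul_le_of_le_one_left (abs_nonneg _) (hq J)).trans (abs_sub_skeleton_le h₁ h₂)
  have hpos := sum_mul_le_of_prod_le_exp (rootScale_pos n) (rootScale_le_one n)
    (q := fun k => ((1 : ℤˣ) : ℤ) * q k) (fun k _ => by simpa using hq k) hstep (hprod 1 J hJ)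
  have hneg := sum_mul_le_of_prod_le_exp (rootScale_pos n) (rootScale_le_one n)
    (q := fun k => ((-1 : ℤˣ) : ℤ) * q k) (fun k _ => by simpa using hq k) hstep (hprod (-1) J hJ)
  simp only [Units.val_one, Units.val_neg, Int.cast_one, Int.cast_neg, one_mul,
    neg_mul, neg_sq, Finset.sum_neg_distrib, rootScale_sq] at hpos hneg
  rw [levelGain_eq h₁ h₂]
  linarith [abs_add_le (∑ k ∈ Finset.range J, q k * (skeleton S n (k + 1) - skeleton S n k))
    (q J * (S t - skeleton S n J)), abs_le.2 ⟨neg_le.1 hneg, hpos⟩]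

theorem forTypicalPaths_hasGainBound {ι : Type*} [Countable ι] {N : ι → ℕ}
    {q : ι → ℕ → PricePath → ℝ} {w : ι → ℝ}
    (hm : ∀ i k, Measurable[(isStoppingTime_lebesguePartition (N i) k).measurableSpace] (q i k))
    (hq : ∀ i k ω, |q i k ω| ≤ 1) (hw : ∀ i, 0 < w i) (hsum : Summable w) :
    ForTypicalPaths fun S => ∃ B > 0, ∀ i,
      HasGainBound S (N i) (fun k => q i k S) (Real.log (B / w i)) := by
  have hsign : ∀ (ε : ℤˣ) (x : ℝ), |(ε : ℤ) * x| = |x| := fun ε x => by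
    rcases Int.units_eq_one_or ε with rfl | rfl <;> simp
  have hsum_sign : Summable fun i : ι × ℤˣ => w i.1 := by
    simpa using hsum.mul_of_nonneg (Summable.of_finite (f := fun _ : ℤˣ => (1 : ℝ)))
      (fun i => (hw i).le) fun _ => zero_le_one
  refine (forTypicalPaths_bets_bounded (ι := ι × ℤˣ) (N := fun i => N i.1)
    (h := fun i k ω => (2 * rootScale (N i.1))⁻¹ * ((i.2 : ℤ) * q i.1 k ω))
    (fun i k => ((hm i.1 k).const_mul _).const_mul _)
    (fun i k ω => ?_) (fun i => hw i.1) hsum_sign).mono ?_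
  · have hρ := rootScale_pos (N i.1)
    rw [abs_mul, hsign, abs_of_pos (by positivity), mul_inv]
    calc 2⁻¹ * (rootScale (N i.1))⁻¹ * |q i.1 k ω| ≤ 1 * (rootScale (N i.1))⁻¹ * 1 := by
          gcongr
          · norm_num
          · exact hq i.1 k ω
      _ ≤ 2 ^ N i.1 := by simpa using inv_rootScale_le_two_pow (N i.1)
  · rintro S ⟨B, hB⟩
    refine ⟨max B 1, by positivity, fun i => hasGainBound_of_prod_le_exp (fun k => hq i k S)
      fun ε J hJ => ?_⟩
    rw [Real.exp_log (div_pos (by positivity) (hw i)), le_div_iff₀' (hw i)]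
    simpa using (hB (i, ε) J hJ).trans (le_max_left B 1)

/-! ### Local positions -/

/-- Indicator of the partition points at which the path lies below `u`. -/
def belowIndicator (S : PricePath) (n : ℕ) (u : ℝ) (l : ℕ) : ℝ :=
  if skeleton S n l < u then 1 else 0

/-- Indicator of the partition points at which the path visits `d`. -/
def visitIndicator (S : PricePath) (n : ℕ) (d : ℝ) (l : ℕ) : ℝ :=
  if skeleton S n l = d then 1 else 0

/-- The change of `belowIndicator` from level `n` to level `n + 1`, as a position along the
partition of level `n + 1`. -/
def levelChange (S : PricePath) (n : ℕ) (d : ℝ) (l : ℕ) : ℝ :=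
  belowIndicator S (n + 1) d l - belowIndicator S n d (coarseIndex S n (n + 1) l)

theorem abs_visitIndicator_le_one (S : PricePath) (n : ℕ) (d : ℝ) (l : ℕ) :
    |visitIndicator S n d l| ≤ 1 := by
  rw [visitIndicator]; split_ifs <;> simp

theorem abs_levelChange_le_one (S : PricePath) (n : ℕ) (d : ℝ) (l : ℕ) :
    |levelChange S n d l| ≤ 1 := by
  rw [levelChange, belowIndicator, belowIndicator]; split_ifs <;> simp

theorem measurable_belowIndicator (n : ℕ) (d : ℝ) (l : ℕ) :
    Measurable[(isStoppingTime_lebesguePartition n l).measurableSpace]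
      fun ω => belowIndicator ω n d l :=
  Measurable.ite (measurable_skeleton le_rfl measurableSet_Iio) measurable_const measurable_const

theorem measurable_visitIndicator (n : ℕ) (d : ℝ) (l : ℕ) :
    Measurable[(isStoppingTime_lebesguePartition n l).measurableSpace]
      fun ω => visitIndicator ω n d l :=
  Measurable.ite (measurable_skeleton le_rfl (measurableSet_singleton d)) measurable_const
    measurable_const

theorem measurable_levelChange (n : ℕ) (d : ℝ) (l : ℕ) :
    Measurable[(isStoppingTime_lebesguePartition (n + 1) l).measurableSpace]
      fun ω => levelChange ω n d l :=
  (measurable_belowIndicator (n + 1) d l).sub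
    (measurable_coarseIndex n.le_succ (measurable_belowIndicator n d) l)

/-- The gains of `visitIndicator` and `levelChange` at the points of the dyadic grids are controlled
by their quadratic variations, up to a logarithmic loss. -/
def HasLocalGainBound (S : PricePath) : Prop :=
  ∃ B > 0, ∀ (n : ℕ) (k : ℤ),
    HasGainBound S n (visitIndicator S n (k * ((2 : ℝ) ^ n)⁻¹))
      (Real.log (B * (1 + (k : ℝ) ^ 2) * 2 ^ n)) ∧
    HasGainBound S (n + 1) (levelChange S n (k * ((2 : ℝ) ^ (n + 1))⁻¹))
      (Real.log (B * (1 + (k : ℝ) ^ 2) * 2 ^ (n + 1)))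

theorem summable_inv_one_add_int_sq : Summable fun k : ℤ => (1 + (k : ℝ) ^ 2)⁻¹ := by
  refine .of_norm_bounded_eventually (Real.summable_one_div_int_pow.2 one_lt_two) ?_
  filter_upwards [(Set.finite_singleton (0 : ℤ)).eventually_cofinite_notMem] with k hk
  have hk0 : (k : ℝ) ≠ 0 := Int.cast_ne_zero.2 hk
  rw [Real.norm_of_nonneg (by positivity), one_div]
  gcongr
  linarith

theorem summable_inv_two_pow_mul_inv_one_add_int_sq :
    Summable fun i : ℕ × ℤ => ((2 : ℝ) ^ i.1)⁻¹ * (1 + (i.2 : ℝ) ^ 2)⁻¹ :=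
  (show Summable fun n : ℕ => ((2 : ℝ) ^ n)⁻¹ by simpa using summable_geometric_two).mul_of_nonneg
    summable_inv_one_add_int_sq (fun n => by positivity) fun k => by positivity

theorem forTypicalPaths_hasLocalGainBound : ForTypicalPaths HasLocalGainBound := by
  set w : (ℕ × ℤ) ⊕ (ℕ × ℤ) → ℝ := Sum.elim
    (fun i => ((2 : ℝ) ^ i.1)⁻¹ * (1 + (i.2 : ℝ) ^ 2)⁻¹)
    fun i => ((2 : ℝ) ^ (i.1 + 1))⁻¹ * (1 + (i.2 : ℝ) ^ 2)⁻¹ with hw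
  have hsum : Summable w := by
    refine .sum w summable_inv_two_pow_mul_inv_one_add_int_sq ?_
    refine (summable_inv_two_pow_mul_inv_one_add_int_sq.mul_left 2⁻¹).congr fun i => ?_
    rw [hw, Function.comp_apply, Sum.elim_inr, pow_succ' _ i.1, mul_inv 2, mul_assoc]
  refine (forTypicalPaths_hasGainBound (N := Sum.elim (fun i => i.1) fun i => i.1 + 1)
    (q := Sum.elim (fun i k ω => visitIndicator ω i.1 (i.2 * ((2 : ℝ) ^ i.1)⁻¹) k)
      fun i k ω => levelChange ω i.1 (i.2 * ((2 : ℝ) ^ (i.1 + 1))⁻¹) k) ?_ ?_ ?_ hsum).mono ?_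
  · rintro (i | i) k
    · exact measurable_visitIndicator i.1 _ k
    · exact measurable_levelChange i.1 _ k
  · rintro (i | i) k ω
    · exact abs_visitIndicator_le_one ω i.1 _ k
    · exact abs_levelChange_le_one ω i.1 _ k
  · rintro (i | i) <;> simp only [hw, Sum.elim_inl, Sum.elim_inr] <;> positivity
  · rintro S ⟨B, hB, hgain⟩
    have hdiv : ∀ (n : ℕ) (k : ℤ), B / (((2 : ℝ) ^ n)⁻¹ * (1 + (k : ℝ) ^ 2)⁻¹) =
        B * (1 + (k : ℝ) ^ 2) * 2 ^ n := fun n k => by field_simp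
    exact ⟨B, hB, fun n k => ⟨hdiv n k ▸ hgain (.inl (n, k)),
      hdiv (n + 1) k ▸ hgain (.inr (n, k))⟩⟩

/-! ### The discrete Tanaka formula -/

/-- The gains up to time `t` of the position `1_{S < u}` along the dyadic Lebesgue partition of
level `n`. -/
def belowGain (S : PricePath) (n : ℕ) (t : ℝ≥0) (u : ℝ) : ℝ :=
  levelGain S n (belowIndicator S n u) t

theorem indicator_uIoc_abs_sub (a b u : ℝ) :
    (Set.uIoc a b).indicator (fun v => |b - v|) u =
      max (u - b) 0 - max (u - a) 0 + (if a < u then 1 else 0) * (b - a) := by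
  rcases lt_or_ge a u with ha | ha <;> rcases lt_or_ge b u with hb | hb
  · simp [Set.indicator, Set.mem_uIoc, ha, hb.not_ge, ha.not_ge, ha.le, hb.le]
  · simp [Set.indicator, Set.mem_uIoc, ha, hb, ha.le, abs_of_nonneg]
  · simp [Set.indicator, Set.mem_uIoc, ha, hb, hb.le, ha.not_gt, abs_of_neg]
  · simp [Set.indicator, Set.mem_uIoc, ha, hb, hb.not_gt, ha.not_gt]

theorem discreteLocalTime_lebesguePartition (S : PricePath) (n : ℕ) (t : ℝ≥0) (u : ℝ) :
    discreteLocalTime S (lebesguePartition S n) t u =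
      max (u - S t) 0 - max (u - S 0) 0 + belowGain S n t u := by
  obtain ⟨J, h₁, h₂⟩ := exists_lebesguePartition_le_lt S n t
  have hsum : discreteLocalTime S (lebesguePartition S n) t u = ∑ l ∈ Finset.range J,
      (Set.uIoc (skeleton S n l) (skeleton S n (l + 1))).indicator
        (fun v => |skeleton S n (l + 1) - v|) u +
      (Set.uIoc (skeleton S n J) (S t)).indicator (fun v => |S t - v|) u :=
    tsum_valueAtMin_eq_sum_add (lebesguePartition_mono S n) h₁ h₂.le
      (fun _ a b => (Set.uIoc a b).indicator (fun v => |b - v|) u) (by simp)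
  have htelescope := Finset.sum_range_sub (fun l => max (u - skeleton S n l) 0) J
  rw [skeleton_zero] at htelescope
  rw [hsum, belowGain, levelGain_eq h₁ h₂.le]
  simp only [indicator_uIoc_abs_sub, Finset.sum_add_distrib, htelescope, belowIndicator]
  ring

theorem belowGain_sub (S : PricePath) (n : ℕ) (t : ℝ≥0) (u v : ℝ) :
    belowGain S n t u - belowGain S n t v =
      levelGain S n (belowIndicator S n u - belowIndicator S n v) t :=
  (levelGain_sub S n _ _ t).symm

theorem belowGain_succ_sub (S : PricePath) (n : ℕ) (t : ℝ≥0) (d : ℝ) :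
    belowGain S (n + 1) t d - belowGain S n t d = levelGain S (n + 1) (levelChange S n d) t := by
  rw [belowGain, belowGain, ← levelGain_coarseIndex S n.le_succ, ← levelGain_sub]
  rfl

theorem belowIndicator_mem_Icc (S : PricePath) (n : ℕ) (u : ℝ) (l : ℕ) :
    belowIndicator S n u l ∈ Set.Icc 0 1 := by
  rw [belowIndicator]; split_ifs <;> simp

theorem abs_belowIndicator_le_one (S : PricePath) (n : ℕ) (u : ℝ) (l : ℕ) :
    |belowIndicator S n u l| ≤ 1 := by
  have hmem := belowIndicator_mem_Icc S n u l
  exact (abs_of_nonneg hmem.1).trans_le hmem.2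

theorem abs_levelGain_le {S : PricePath} {n J : ℕ} {F : ℕ → ℝ} {t : ℝ≥0} (hF : ∀ l, |F l| ≤ 1)
    (h₁ : lebesguePartition S n J ≤ t) (h₂ : t ≤ lebesguePartition S n (J + 1)) :
    |levelGain S n F t| ≤ (J + 1) * ((2 : ℝ) ^ n)⁻¹ := by
  have hJ := ne_top_of_le_ne_top WithTop.coe_ne_top h₁
  have hmul : ∀ l {x : ℝ}, |x| ≤ ((2 : ℝ) ^ n)⁻¹ → |F l * x| ≤ ((2 : ℝ) ^ n)⁻¹ := fun l x hx => by
    rw [abs_mul]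
    exact (mul_le_of_le_one_left (abs_nonneg x) (hF l)).trans hx
  have hsum : |∑ l ∈ Finset.range J, F l * (skeleton S n (l + 1) - skeleton S n l)| ≤
      J * ((2 : ℝ) ^ n)⁻¹ := by
    refine (Finset.abs_sum_le_sum_abs _ _).trans ((Finset.sum_le_card_nsmul _ _ _ fun l hl =>
      hmul l (abs_skeleton_succ_sub_le
        (lebesguePartition_ne_top_of_le hJ (Finset.mem_range.1 hl)))).trans_eq ?_)
    rw [Finset.card_range, nsmul_eq_mul]
  rw [levelGain_eq h₁ h₂]
  linarith [abs_add_le (∑ l ∈ Finset.range J, F l * (skeleton S n (l + 1) - skeleton S n l))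
    (F J * (S t - skeleton S n J)), hmul J (abs_sub_skeleton_le h₁ h₂)]

theorem exists_abs_belowGain_le (S : PricePath) (T : ℝ≥0) (n : ℕ) :
    ∃ m, ∀ t ≤ T, ∀ u, |belowGain S n t u| ≤ m := by
  obtain ⟨J, -, hTJ⟩ := exists_lebesguePartition_le_lt S n T
  refine ⟨(J + 1) * ((2 : ℝ) ^ n)⁻¹, fun t ht u => ?_⟩
  obtain ⟨I, h₁, h₂⟩ := exists_lebesguePartition_le_lt S n t
  have hIJ : I < J + 1 := (lebesguePartition_mono S n).reflect_lt
    (h₁.trans_lt ((WithTop.coe_le_coe.2 ht).trans_lt hTJ))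
  refine (abs_levelGain_le (abs_belowIndicator_le_one S n u) h₁ h₂.le).trans ?_
  gcongr
  exact Nat.le_of_lt_succ hIJ

/-! ### Increments of the gains in space -/

-- The starting point `S 0` is the only point of the skeleton that need not lie on the grid.
theorem abs_levelGain_le_of_forall_succ_eq_zero {S : PricePath} {n : ℕ} {F : ℕ → ℝ}
    (hF : ∀ l, lebesguePartition S n (l + 1) ≠ ⊤ → F (l + 1) = 0) (t : ℝ≥0) :
    |levelGain S n F t| ≤ |F 0| * ((2 : ℝ) ^ n)⁻¹ := by
  obtain ⟨J, h₁, h₂⟩ := exists_lebesguePartition_le_lt S n t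
  have hJ := ne_top_of_le_ne_top WithTop.coe_ne_top h₁
  rw [levelGain_eq h₁ h₂.le]
  rcases J with _ | J
  · rw [Finset.sum_range_zero, zero_add, abs_mul]
    gcongr
    exact abs_sub_skeleton_le h₁ h₂.le
  · have hzero : ∀ l ∈ Finset.range J,
        F (l + 1) * (skeleton S n (l + 1 + 1) - skeleton S n (l + 1)) = 0 := fun l hl => by
      have hlJ : l + 1 ≤ J + 1 := Nat.succ_le_succ (Finset.mem_range.1 hl).le
      rw [hF l (lebesguePartition_ne_top_of_le hJ hlJ), zero_mul]
    rw [hF J hJ, zero_mul, add_zero, Finset.sum_range_succ', Finset.sum_eq_zero hzero, zero_add,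
      abs_mul]
    gcongr
    exact abs_skeleton_succ_sub_le (lebesguePartition_ne_top_of_le hJ J.succ_pos)

theorem lt_iff_lt_ceil_of_mem_dyadicGrid {n : ℕ} {x u : ℝ} (hx : x ∈ dyadicGrid n) :
    x < u ↔ x < ⌈u * 2 ^ n⌉ * ((2 : ℝ) ^ n)⁻¹ := by
  obtain ⟨m, rfl⟩ := hx
  have hpos : (0 : ℝ) < 2 ^ n := by positivity
  rw [← div_eq_mul_inv, ← div_eq_mul_inv, div_lt_div_iff_of_pos_right hpos, Int.cast_lt,
    Int.lt_ceil, div_lt_iff₀ hpos]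

theorem abs_belowIndicator_sub_le_one (S : PricePath) (n : ℕ) (u v : ℝ) (l : ℕ) :
    |belowIndicator S n u l - belowIndicator S n v l| ≤ 1 :=
  abs_sub_le_of_nonneg_of_le (belowIndicator_mem_Icc S n u l).1 (belowIndicator_mem_Icc S n u l).2
    (belowIndicator_mem_Icc S n v l).1 (belowIndicator_mem_Icc S n v l).2

theorem abs_belowGain_sub_le_of_ceil_eq (S : PricePath) {n m : ℕ} (hnm : n ≤ m) (t : ℝ≥0)
    {u v : ℝ} (h : ⌈u * 2 ^ m⌉ = ⌈v * 2 ^ m⌉) :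
    |belowGain S n t u - belowGain S n t v| ≤
      |belowIndicator S n u 0 - belowIndicator S n v 0| * ((2 : ℝ) ^ n)⁻¹ := by
  rw [belowGain_sub]
  refine abs_levelGain_le_of_forall_succ_eq_zero (fun l hl => ?_) t
  have hmem := dyadicGrid_mono hnm (skeleton_succ_mem hl)
  have hlt : skeleton S n (l + 1) < u ↔ skeleton S n (l + 1) < v := by
    rw [lt_iff_lt_ceil_of_mem_dyadicGrid hmem, lt_iff_lt_ceil_of_mem_dyadicGrid (u := v) hmem, h]
  simp only [Pi.sub_apply, belowIndicator, hlt, sub_self]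

theorem abs_belowGain_sub_ceil_le (S : PricePath) {n m : ℕ} (hnm : n ≤ m) (t : ℝ≥0) (u : ℝ) :
    |belowGain S n t u - belowGain S n t (⌈u * 2 ^ m⌉ * ((2 : ℝ) ^ m)⁻¹)| ≤ ((2 : ℝ) ^ n)⁻¹ := by
  refine (abs_belowGain_sub_le_of_ceil_eq S hnm t ?_).trans
    (mul_le_of_le_one_left (by positivity) (abs_belowIndicator_sub_le_one S n _ _ 0))
  rw [inv_mul_cancel_right₀ (by positivity), Int.ceil_intCast]

theorem abs_belowGain_succ_sub_le (S : PricePath) (n : ℕ) (t : ℝ≥0) (k : ℤ) :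
    |belowGain S n t ((k + 1 : ℤ) * ((2 : ℝ) ^ n)⁻¹) - belowGain S n t (k * ((2 : ℝ) ^ n)⁻¹) -
      levelGain S n (visitIndicator S n (k * ((2 : ℝ) ^ n)⁻¹)) t| ≤ ((2 : ℝ) ^ n)⁻¹ := by
  have hpos : (0 : ℝ) < ((2 : ℝ) ^ n)⁻¹ := by positivity
  have hlt : k * ((2 : ℝ) ^ n)⁻¹ < (k + 1 : ℤ) * ((2 : ℝ) ^ n)⁻¹ := by push_cast; nlinarith
  rw [belowGain_sub, ← levelGain_sub]
  refine (abs_levelGain_le_of_forall_succ_eq_zero (fun l hl => ?_) t).trans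
    (mul_le_of_le_one_left hpos.le ?_)
  · obtain ⟨m, hm⟩ := skeleton_succ_mem hl
    simp only [Pi.sub_apply, belowIndicator, visitIndicator, hm, mul_lt_mul_iff_left₀ hpos,
      Int.cast_lt, mul_left_inj' hpos.ne', Int.cast_inj, Int.lt_add_one_iff, le_iff_lt_or_eq]
    split_ifs <;> first | omega | norm_num
  · simp only [Pi.sub_apply, belowIndicator, visitIndicator]
    split_ifs <;> first | (exfalso; linarith) | norm_num

/-! ### Visits of grid points -/

theorem levelGain_eq_sum {S : PricePath} {n J : ℕ} {t : ℝ≥0} (h : lebesguePartition S n J = t)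
    (F : ℕ → ℝ) : levelGain S n F t =
      ∑ l ∈ Finset.range J, F l * (skeleton S n (l + 1) - skeleton S n l) := by
  rw [levelGain_eq h.le (h ▸ lebesguePartition_le_succ S n J), skeleton_eq h, sub_self, mul_zero,
    add_zero]

theorem visitIndicator_le {S : PricePath} {n l : ℕ} {d : ℝ} (hd : d ∈ dyadicGrid n)
    (hl : lebesguePartition S n (l + 1) ≠ ⊤) :
    ((2 : ℝ) ^ n)⁻¹ * visitIndicator S n d l ≤
      |skeleton S n (l + 1) - d| - |skeleton S n l - d| -
      (skeleton S n (l + 1) - skeleton S n l) +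
      2 * (belowIndicator S n d l * (skeleton S n (l + 1) - skeleton S n l)) +
      visitIndicator S n d l * (skeleton S n (l + 1) - skeleton S n l) := by
  rw [visitIndicator, belowIndicator]
  rcases lt_trichotomy (skeleton S n l) d with hlt | rfl | hgt
  · rw [if_neg hlt.ne, if_pos hlt, abs_of_neg (sub_neg.2 hlt)]
    linarith [neg_abs_le (skeleton S n (l + 1) - d)]
  · rw [if_pos rfl, if_neg (lt_irrefl _), sub_self, abs_zero]
    linarith [le_abs_sub_of_mem_dyadicGrid (skeleton_succ_mem hl) hd (skeleton_succ_ne hl)]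
  · rw [if_neg hgt.ne', if_neg hgt.not_gt, abs_of_pos (sub_pos.2 hgt)]
    linarith [le_abs_self (skeleton S n (l + 1) - d)]

theorem sum_visitIndicator_le {S : PricePath} {n J : ℕ} {t : ℝ≥0} {d : ℝ}
    (hd : d ∈ dyadicGrid n) (h : lebesguePartition S n J = t) :
    ((2 : ℝ) ^ n)⁻¹ * ∑ l ∈ Finset.range J, visitIndicator S n d l ≤
      |S t - d| - |S 0 - d| - (S t - S 0) + 2 * belowGain S n t d +
        levelGain S n (visitIndicator S n d) t := by
  have hsum := Finset.sum_le_sum fun l (hl : l ∈ Finset.range J) => visitIndicator_le hd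
    (lebesguePartition_ne_top_of_le (h ▸ WithTop.coe_ne_top) (Finset.mem_range.1 hl))
  have habs := Finset.sum_range_sub (fun l => |skeleton S n l - d|) J
  have hid := Finset.sum_range_sub (fun l => skeleton S n l) J
  rw [skeleton_eq h, skeleton_zero] at habs hid
  rw [belowGain, levelGain_eq_sum h, levelGain_eq_sum h, Finset.mul_sum, Finset.mul_sum]
  simp only [Finset.sum_add_distrib, Finset.sum_sub_distrib] at hsum habs hid
  simp only [← Finset.mul_sum] at hsum ⊢
  linarith

theorem abs_sub_le_of_levelChange_ne_zero {S : PricePath} {n l : ℕ} {d : ℝ}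
    (hl : lebesguePartition S (n + 1) l ≠ ⊤) (hne : levelChange S n d l ≠ 0) :
    |skeleton S (n + 1) l - d| ≤ ((2 : ℝ) ^ n)⁻¹ := by
  obtain ⟨t, ht⟩ := WithTop.ne_top_iff_exists.1 hl
  obtain ⟨hle, hlt⟩ := coarseIndex_spec n.le_succ hl
  have hclose := abs_le.1 (abs_sub_skeleton_le (ht ▸ hle) (ht ▸ hlt.le))
  rw [← skeleton_eq ht.symm] at hclose
  rw [levelChange, belowIndicator, belowIndicator] at hne
  rw [abs_le]
  split_ifs at hne
  · exact absurd (sub_self _) hne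
  · constructor <;> linarith
  · constructor <;> linarith
  · exact absurd (sub_self _) hne

theorem visitIndicator_nonneg (S : PricePath) (n : ℕ) (d : ℝ) (l : ℕ) :
    0 ≤ visitIndicator S n d l := by
  rw [visitIndicator]; split_ifs <;> simp

theorem sq_levelChange_le {S : PricePath} {n l : ℕ} (k : ℤ)
    (hl : lebesguePartition S (n + 1) l ≠ ⊤) :
    levelChange S n (k * ((2 : ℝ) ^ (n + 1))⁻¹) l ^ 2 ≤ ∑ i ∈ Finset.Icc (-2 : ℤ) 2,
      visitIndicator S (n + 1) ((k + i : ℤ) * ((2 : ℝ) ^ (n + 1))⁻¹) l := by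
  have hnonneg : ∀ i ∈ Finset.Icc (-2 : ℤ) 2,
      0 ≤ visitIndicator S (n + 1) ((k + i : ℤ) * ((2 : ℝ) ^ (n + 1))⁻¹) l :=
    fun i _ => visitIndicator_nonneg S (n + 1) _ l
  by_cases hne : levelChange S n (k * ((2 : ℝ) ^ (n + 1))⁻¹) l = 0
  · rw [hne, sq, mul_zero]
    exact Finset.sum_nonneg hnonneg
  rcases l with _ | l
  · exact absurd (sub_self _) hne
  obtain ⟨j, hj⟩ := skeleton_succ_mem hl
  have hclose : |j - k| ≤ 2 := by
    have hdist := abs_sub_le_of_levelChange_ne_zero hl hne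
    rw [hj, ← sub_mul, abs_mul, abs_of_pos (a := ((2 : ℝ) ^ (n + 1))⁻¹) (by positivity),
      mul_inv_le_iff₀ (by positivity), pow_succ, inv_mul_cancel_left₀ (by positivity)] at hdist
    exact_mod_cast hdist
  calc levelChange S n (k * ((2 : ℝ) ^ (n + 1))⁻¹) (l + 1) ^ 2 ≤ 1 :=
        (sq_le_one_iff_abs_le_one _).2 (abs_levelChange_le_one S n _ _)
    _ = visitIndicator S (n + 1) ((k + (j - k) : ℤ) * ((2 : ℝ) ^ (n + 1))⁻¹) (l + 1) := by
        rw [visitIndicator, if_pos (by rw [hj, add_sub_cancel])]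
    _ ≤ _ := Finset.single_le_sum hnonneg (Finset.mem_Icc.2 (abs_le.1 hclose))

section Bounded

variable {S : PricePath} {T : ℝ≥0} {R : ℝ} {n : ℕ} {t : ℝ≥0}

theorem abs_skeleton_le (hR : ∀ t ≤ T, |S t| ≤ R) {J : ℕ} (ht : t ≤ T)
    (h : lebesguePartition S n J ≤ t) : |skeleton S n J| ≤ R := by
  obtain ⟨r, hr⟩ := WithTop.ne_top_iff_exists.1 (ne_top_of_le_ne_top WithTop.coe_ne_top h)
  rw [skeleton_eq hr.symm]
  exact hR r ((WithTop.coe_le_coe.1 (hr ▸ h)).trans ht)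

theorem belowGain_of_lt (hR : ∀ t ≤ T, |S t| ≤ R) (n : ℕ) (ht : t ≤ T) {u : ℝ} (hu : R < u) :
    belowGain S n t u = S t - S 0 := by
  obtain ⟨J, h₁, h₂⟩ := exists_lebesguePartition_le_lt S n t
  have hbelow : ∀ l ≤ J, belowIndicator S n u l = 1 := fun l hl =>
    if_pos ((le_of_abs_le (abs_skeleton_le hR ht
      ((lebesguePartition_mono S n hl).trans h₁))).trans_lt hu)
  rw [belowGain, levelGain_eq h₁ h₂.le, hbelow J le_rfl,
    Finset.sum_congr rfl fun l hl => by rw [hbelow l (Finset.mem_range.1 hl).le, one_mul],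
    Finset.sum_range_sub, skeleton_zero]
  ring

theorem belowGain_of_le (hR : ∀ t ≤ T, |S t| ≤ R) (n : ℕ) (ht : t ≤ T) {u : ℝ} (hu : u ≤ -R) :
    belowGain S n t u = 0 := by
  obtain ⟨J, h₁, h₂⟩ := exists_lebesguePartition_le_lt S n t
  have hbelow : ∀ l ≤ J, belowIndicator S n u l = 0 := fun l hl =>
    if_neg (hu.trans (neg_le_of_abs_le (abs_skeleton_le hR ht
      ((lebesguePartition_mono S n hl).trans h₁)))).not_gt
  rw [belowGain, levelGain_eq h₁ h₂.le, hbelow J le_rfl,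
    Finset.sum_eq_zero fun l hl => by rw [hbelow l (Finset.mem_range.1 hl).le, zero_mul]]
  ring

theorem belowGain_eq_of_lt_abs (hR : ∀ t ≤ T, |S t| ≤ R) (n m : ℕ) (ht : t ≤ T) {u v : ℝ}
    (hu : R + 1 < |u|) (huv : |v - u| ≤ 1) : belowGain S n t v = belowGain S m t u := by
  obtain ⟨hle, hge⟩ := abs_le.1 huv
  rcases lt_abs.1 hu with hpos | hneg
  · rw [belowGain_of_lt hR n ht (by linarith), belowGain_of_lt hR m ht (by linarith)]
  · rw [belowGain_of_le hR n ht (by linarith), belowGain_of_le hR m ht (by linarith)]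

-- The number of visits is at most of the order of `belowGain`, which in turn is estimated through
-- the number of visits; a Gronwall argument over the levels closes this loop.
theorem sum_visitIndicator_le_of_abs_belowGain_le (hR : ∀ t ≤ T, |S t| ≤ R) {m : ℝ}
    (hm : ∀ t ≤ T, ∀ u, |belowGain S n t u| ≤ m) {J : ℕ} (ht : t ≤ T)
    (h : lebesguePartition S n J ≤ t) (k : ℤ) :
    ((2 : ℝ) ^ n)⁻¹ * ∑ l ∈ Finset.range J, visitIndicator S n (k * ((2 : ℝ) ^ n)⁻¹) l ≤
      4 * R + 4 * m + 1 := by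
  obtain ⟨r, hr⟩ := WithTop.ne_top_iff_exists.1 (ne_top_of_le_ne_top WithTop.coe_ne_top h)
  have hrT : r ≤ T := (WithTop.coe_le_coe.1 (hr ▸ h)).trans ht
  have hvisits := sum_visitIndicator_le ⟨k, rfl⟩ hr.symm
  set d := k * ((2 : ℝ) ^ n)⁻¹
  have hspace := abs_le.1 (abs_belowGain_succ_sub_le S n r k)
  have habs := (abs_sub_abs_le_abs_sub (S r - d) (S 0 - d)).trans_eq
    (congrArg abs (sub_sub_sub_cancel_right (S r) (S 0) d))
  have hdiff : |S r - S 0| ≤ 2 * R := (abs_sub _ _).trans (by linarith [hR r hrT, hR 0 bot_le])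
  linarith [abs_le.1 (hm r hrT d), abs_le.1 (hm r hrT ((k + 1 : ℤ) * ((2 : ℝ) ^ n)⁻¹)),
    abs_le.1 hdiff, inv_le_one_of_one_le₀ (one_le_pow₀ (one_le_two (α := ℝ)) (n := n))]

theorem sum_sq_levelChange_le (hR : ∀ t ≤ T, |S t| ≤ R) {m : ℝ}
    (hm : ∀ t ≤ T, ∀ u, |belowGain S (n + 1) t u| ≤ m) {J : ℕ} (ht : t ≤ T)
    (h : lebesguePartition S (n + 1) J ≤ t) (k : ℤ) :
    ((2 : ℝ) ^ (n + 1))⁻¹ *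
        ∑ l ∈ Finset.range J, levelChange S n (k * ((2 : ℝ) ^ (n + 1))⁻¹) l ^ 2 ≤
      5 * (4 * R + 4 * m + 1) := by
  have hJ := ne_top_of_le_ne_top WithTop.coe_ne_top h
  calc ((2 : ℝ) ^ (n + 1))⁻¹ *
        ∑ l ∈ Finset.range J, levelChange S n (k * ((2 : ℝ) ^ (n + 1))⁻¹) l ^ 2
      ≤ ((2 : ℝ) ^ (n + 1))⁻¹ * ∑ l ∈ Finset.range J, ∑ i ∈ Finset.Icc (-2 : ℤ) 2,
          visitIndicator S (n + 1) ((k + i : ℤ) * ((2 : ℝ) ^ (n + 1))⁻¹) l := by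
        gcongr with l hl
        exact sq_levelChange_le k (lebesguePartition_ne_top_of_le hJ (Finset.mem_range.1 hl).le)
    _ = ∑ i ∈ Finset.Icc (-2 : ℤ) 2, ((2 : ℝ) ^ (n + 1))⁻¹ * ∑ l ∈ Finset.range J,
          visitIndicator S (n + 1) ((k + i : ℤ) * ((2 : ℝ) ^ (n + 1))⁻¹) l := by
        rw [Finset.sum_comm, Finset.mul_sum]
    _ ≤ (Finset.Icc (-2 : ℤ) 2).card • (4 * R + 4 * m + 1) :=
        Finset.sum_le_card_nsmul _ _ _ fun i _ =>
          sum_visitIndicator_le_of_abs_belowGain_le hR hm ht h (k + i)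
    _ = 5 * (4 * R + 4 * m + 1) := nsmul_eq_mul _ _

end Bounded

/-! ### Estimates uniform in the level -/

theorem exists_abs_le (S : PricePath) (T : ℝ≥0) : ∃ R, ∀ t ≤ T, |S t| ≤ R := by
  obtain ⟨R, hR⟩ := (isCompact_Icc (a := (0 : ℝ≥0)) (b := T)).exists_bound_of_continuousOn
    S.continuous.continuousOn
  exact ⟨R, fun t ht => hR t ⟨bot_le, ht⟩⟩

theorem log_mul_two_pow_le {B R : ℝ} (hB : 0 < B) {n : ℕ} {k : ℤ}
    (hk : |k * ((2 : ℝ) ^ n)⁻¹| ≤ R) :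
    Real.log (B * (1 + (k : ℝ) ^ 2) * 2 ^ n) ≤ |Real.log (B * (1 + R ^ 2))| + 3 * n := by
  have hpow : (1 : ℝ) ≤ (2 ^ n) ^ 2 := one_le_pow₀ (one_le_pow₀ one_le_two)
  have hsq : (k : ℝ) ^ 2 ≤ R ^ 2 * (2 ^ n) ^ 2 := by
    rw [abs_mul, abs_of_pos (a := ((2 : ℝ) ^ n)⁻¹) (by positivity), ← div_eq_mul_inv,
      div_le_iff₀ (by positivity)] at hk
    rw [← sq_abs, ← mul_pow]
    gcongr
  have hweight : B * (1 + (k : ℝ) ^ 2) * 2 ^ n ≤ B * (1 + R ^ 2) * (2 ^ n) ^ 3 := by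
    calc B * (1 + (k : ℝ) ^ 2) * 2 ^ n ≤ B * ((1 + R ^ 2) * (2 ^ n) ^ 2) * 2 ^ n := by
          gcongr
          linarith
      _ = B * (1 + R ^ 2) * (2 ^ n) ^ 3 := by ring
  have hlog := Real.log_le_log (by positivity) hweight
  rw [Real.log_mul (y := (2 ^ n) ^ 3) (by positivity) (by positivity), Real.log_pow,
    Real.log_pow] at hlog
  have hlog_two : (n : ℝ) * Real.log 2 ≤ n :=
    mul_le_of_le_one_right n.cast_nonneg (Real.log_two_lt_d9.le.trans (by norm_num))
  push_cast at hlog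
  linarith [le_abs_self (Real.log (B * (1 + R ^ 2)))]

theorem inv_two_pow_le_one (n : ℕ) : ((2 : ℝ) ^ n)⁻¹ ≤ 1 :=
  inv_le_one_of_one_le₀ (one_le_pow₀ one_le_two)

/-- The order of magnitude of the increments of `belowGain`, in space between neighbouring points of
the grid of level `n` and in the level. -/
def incrementRate (n : ℕ) : ℝ := rootScale n * (n + 1)

theorem incrementRate_nonneg (n : ℕ) : 0 ≤ incrementRate n :=
  mul_nonneg (rootScale_pos n).le (by positivity)

theorem inv_two_pow_le_incrementRate (n : ℕ) : ((2 : ℝ) ^ n)⁻¹ ≤ incrementRate n := by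
  have hpos := rootScale_pos n
  calc ((2 : ℝ) ^ n)⁻¹ = rootScale n * rootScale n := by rw [← rootScale_sq, sq]
    _ ≤ rootScale n * (n + 1) := by
      gcongr
      exact (rootScale_le_one n).trans (by simp)

theorem incrementRate_succ_le (n : ℕ) : incrementRate (n + 1) ≤ 2 * incrementRate n := by
  have hanti : rootScale (n + 1) ≤ rootScale n := by
    rw [rootScale, rootScale]
    gcongr
    exacts [Real.one_le_sqrt.2 one_le_two, n.le_succ]
  calc incrementRate (n + 1) = rootScale (n + 1) * (n + 2) := by rw [incrementRate]; push_cast; ring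
    _ ≤ rootScale n * (2 * (n + 1)) := by
      have hpos := rootScale_pos n
      gcongr
      linarith [(Nat.cast_nonneg n : (0 : ℝ) ≤ n)]
    _ = 2 * incrementRate n := by rw [incrementRate]; ring

theorem summable_mul_pow_of_lt_one {r : ℝ} (hr₀ : 0 ≤ r) (hr : r < 1) :
    Summable fun n : ℕ => r ^ n * (n + 1) := by
  have hnorm : ‖r‖ < 1 := by rwa [Real.norm_of_nonneg hr₀]
  refine ((summable_pow_mul_geometric_of_norm_lt_one 1 hnorm).add
    (summable_geometric_of_norm_lt_one hnorm)).congr fun n => ?_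
  ring

theorem summable_incrementRate : Summable incrementRate := by
  have hlt : (√2)⁻¹ < 1 := inv_lt_one_of_one_lt₀ (Real.lt_sqrt_of_sq_lt (by norm_num))
  refine (summable_mul_pow_of_lt_one (by positivity) hlt).congr fun n => ?_
  rw [incrementRate, rootScale, inv_pow]

theorem HasGainBound.abs_levelGain_le {S : PricePath} {n : ℕ} {q : ℕ → ℝ} {Λ V : ℝ}
    (h : HasGainBound S n q Λ) {t : ℝ≥0}
    (hV : ∀ J, lebesguePartition S n J ≤ t →
      ((2 : ℝ) ^ n)⁻¹ * ∑ l ∈ Finset.range J, q l ^ 2 ≤ V) :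
    |levelGain S n q t| ≤ rootScale n * (1 + 2 * Λ + V) := by
  obtain ⟨J, h₁, h₂⟩ := exists_lebesguePartition_le_lt S n t
  have hpos := rootScale_pos n
  calc |levelGain S n q t| ≤ _ := h J t h₁ h₂.le
    _ ≤ rootScale n * 1 + 2 * rootScale n * Λ + rootScale n * V := by
      rw [sq]
      gcongr
      exacts [rootScale_le_one n, hV J h₁]
    _ = rootScale n * (1 + 2 * Λ + V) := by ring

theorem HasGainBound.abs_levelGain_le_incrementRate {S : PricePath} {n : ℕ} {q : ℕ → ℝ} {k : ℤ}
    {t : ℝ≥0} {B R m : ℝ}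
    (h : HasGainBound S n q (Real.log (B * (1 + (k : ℝ) ^ 2) * 2 ^ n))) (hB : 0 < B) (hR : 0 ≤ R)
    (hm : 0 ≤ m) (hk : |k * ((2 : ℝ) ^ n)⁻¹| ≤ R + 1)
    (hV : ∀ J, lebesguePartition S n J ≤ t →
      ((2 : ℝ) ^ n)⁻¹ * ∑ l ∈ Finset.range J, q l ^ 2 ≤ 5 * (4 * R + 4 * m + 1)) :
    |levelGain S n q t| ≤
      (26 + 2 * |Real.log (B * (1 + (R + 1) ^ 2))| + 20 * R) * incrementRate n * (1 + m) := by
  have hlog := log_mul_two_pow_le hB hk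
  set c := |Real.log (B * (1 + (R + 1) ^ 2))|
  calc |levelGain S n q t| ≤ _ := h.abs_levelGain_le hV
    _ ≤ rootScale n * ((26 + 2 * c + 20 * R) * (1 + n + m + n * m)) := by
      have hpos := rootScale_pos n
      gcongr
      have hn : (0 : ℝ) ≤ n := n.cast_nonneg
      have hsum : 0 ≤ (2 * c + 20 * R) * (n + m + n * m) := by positivity
      linarith [mul_nonneg hn hm]
    _ = (26 + 2 * c + 20 * R) * incrementRate n * (1 + m) := by rw [incrementRate]; ring

theorem HasLocalGainBound.exists_abs_levelGain_le {S : PricePath} (hS : HasLocalGainBound S)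
    {T : ℝ≥0} {R : ℝ} (hR : ∀ t ≤ T, |S t| ≤ R) :
    ∃ C ≥ 0, ∀ (n : ℕ) (k : ℤ) (m : ℝ), ∀ t ≤ T,
      ((∀ t ≤ T, ∀ u, |belowGain S n t u| ≤ m) → |k * ((2 : ℝ) ^ n)⁻¹| ≤ R + 1 →
        |levelGain S n (visitIndicator S n (k * ((2 : ℝ) ^ n)⁻¹)) t| ≤
          C * incrementRate n * (1 + m)) ∧
      ((∀ t ≤ T, ∀ u, |belowGain S (n + 1) t u| ≤ m) → |k * ((2 : ℝ) ^ (n + 1))⁻¹| ≤ R + 1 →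
        |levelGain S (n + 1) (levelChange S n (k * ((2 : ℝ) ^ (n + 1))⁻¹)) t| ≤
          C * incrementRate (n + 1) * (1 + m)) := by
  obtain ⟨B, hB, hgain⟩ := hS
  have hR₀ : 0 ≤ R := (abs_nonneg _).trans (hR 0 bot_le)
  refine ⟨26 + 2 * |Real.log (B * (1 + (R + 1) ^ 2))| + 20 * R, by positivity,
    fun n k m t ht => ⟨fun hm hk => ?_, fun hm hk => ?_⟩⟩ <;>
    have hm₀ : 0 ≤ m := (abs_nonneg _).trans (hm 0 bot_le 0)
  · refine (hgain n k).1.abs_levelGain_le_incrementRate hB hR₀ hm₀ hk fun J hJ => ?_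
    have hsq : ∀ l, visitIndicator S n (k * ((2 : ℝ) ^ n)⁻¹) l ^ 2 =
        visitIndicator S n (k * ((2 : ℝ) ^ n)⁻¹) l := fun l => by
      rw [visitIndicator]; split_ifs <;> norm_num
    simp only [hsq]
    linarith [sum_visitIndicator_le_of_abs_belowGain_le hR hm ht hJ k]
  · exact (hgain n k).2.abs_levelGain_le_incrementRate hB hR₀ hm₀ hk fun J hJ =>
      sum_sq_levelChange_le hR hm ht hJ k

theorem HasLocalGainBound.exists_abs_belowGain_succ_sub_le {S : PricePath}
    (hS : HasLocalGainBound S) (T : ℝ≥0) :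
    ∃ C ≥ 0, ∀ (n : ℕ) (m : ℝ), ∀ t ≤ T,
      ((∀ t ≤ T, ∀ u, |belowGain S n t u| ≤ m) → ∀ k : ℤ,
        |belowGain S n t ((k + 1 : ℤ) * ((2 : ℝ) ^ n)⁻¹) -
          belowGain S n t (k * ((2 : ℝ) ^ n)⁻¹)| ≤ C * incrementRate n * (1 + m)) ∧
      ((∀ t ≤ T, ∀ u, |belowGain S (n + 1) t u| ≤ m) → ∀ u,
        |belowGain S (n + 1) t u - belowGain S n t u| ≤ C * incrementRate (n + 1) * (1 + m)) := by
  obtain ⟨R, hR⟩ := exists_abs_le S T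
  obtain ⟨C, hC₀, hC⟩ := hS.exists_abs_levelGain_le hR
  have hgap : ∀ n {m : ℝ}, 0 ≤ m → ((2 : ℝ) ^ n)⁻¹ ≤ incrementRate n * (1 + m) := fun n m hm =>
    (inv_two_pow_le_incrementRate n).trans
      (le_mul_of_one_le_right (incrementRate_nonneg n) (le_add_of_nonneg_right hm))
  refine ⟨C + 3, by positivity, fun n m t ht => ⟨fun hm k => ?_, fun hm u => ?_⟩⟩ <;>
    have hm₀ : 0 ≤ m := (abs_nonneg _).trans (hm 0 bot_le 0)
  · have hgap := hgap n hm₀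
    have hrate : 0 ≤ C * (incrementRate n * (1 + m)) :=
      mul_nonneg hC₀ ((by positivity : (0 : ℝ) ≤ _).trans hgap)
    rcases le_or_gt |k * ((2 : ℝ) ^ n)⁻¹| (R + 1) with hk | hk
    · have hspace := abs_belowGain_succ_sub_le S n t k
      have hvisit := (hC n k m t ht).1 hm hk
      rw [abs_le] at hspace hvisit ⊢
      constructor <;> linarith
    · have hstep : |(k + 1 : ℤ) * ((2 : ℝ) ^ n)⁻¹ - k * ((2 : ℝ) ^ n)⁻¹| ≤ 1 := by
        rw [← sub_mul, Int.cast_add, add_sub_cancel_left, Int.cast_one, one_mul,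
          abs_of_pos (by positivity)]
        exact inv_two_pow_le_one n
      rw [belowGain_eq_of_lt_abs hR n n ht hk hstep, sub_self, abs_zero]
      linarith [inv_nonneg.2 (pow_nonneg (zero_le_two (α := ℝ)) n)]
  · have hgap := hgap (n + 1) hm₀
    have hgrid : |belowGain S (n + 1) t (⌈u * 2 ^ (n + 1)⌉ * ((2 : ℝ) ^ (n + 1))⁻¹) -
        belowGain S n t (⌈u * 2 ^ (n + 1)⌉ * ((2 : ℝ) ^ (n + 1))⁻¹)| ≤
        C * incrementRate (n + 1) * (1 + m) := by
      rcases le_or_gt |⌈u * 2 ^ (n + 1)⌉ * ((2 : ℝ) ^ (n + 1))⁻¹| (R + 1) with hk | hk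
      · rw [belowGain_succ_sub]
        exact (hC n _ m t ht).2 hm hk
      · rw [belowGain_eq_of_lt_abs hR (n + 1) n ht hk (by simp), sub_self, abs_zero]
        have hrate := incrementRate_nonneg (n + 1)
        positivity
    have hfine := abs_belowGain_sub_ceil_le S (le_refl (n + 1)) t u
    have hcoarse := abs_belowGain_sub_ceil_le S n.le_succ t u
    have hpow : ((2 : ℝ) ^ n)⁻¹ = 2 * ((2 : ℝ) ^ (n + 1))⁻¹ := by rw [pow_succ, mul_inv]; ring
    rw [abs_le] at hfine hcoarse hgrid ⊢
    constructor <;> linarith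

theorem exists_le_of_le_add_mul {a ε : ℕ → ℝ} (ha : ∀ n, 0 ≤ a n) (hε : ∀ n, 0 ≤ ε n)
    (hsum : Summable ε) (h : ∀ n, a (n + 1) ≤ a n + ε n * (1 + a (n + 1))) :
    ∃ M, ∀ n, a n ≤ M := by
  obtain ⟨n₀, hn₀⟩ := eventually_atTop.1
    (hsum.tendsto_atTop_zero.eventually (ge_mem_nhds one_half_pos))
  have hstep : ∀ n ≥ n₀, 1 + a (n + 1) ≤ (1 + 2 * ε n) * (1 + a n) + 0 := fun n hn => by
    have hinv : 1 ≤ (1 + 2 * ε n) * (1 - ε n) := by nlinarith [hn₀ n hn, hε n]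
    calc 1 + a (n + 1) ≤ (1 + 2 * ε n) * (1 - ε n) * (1 + a (n + 1)) :=
          le_mul_of_one_le_left (by linarith [ha (n + 1)]) hinv
      _ = (1 + 2 * ε n) * (1 + a (n + 1) - ε n * (1 + a (n + 1))) := by ring
      _ ≤ (1 + 2 * ε n) * (1 + a n) + 0 := by
        rw [add_zero]
        gcongr
        · linarith [hε n]
        · linarith [h n]
  have hbound : ∀ n, n₀ ≤ n → a n ≤ (1 + a n₀) * Real.exp (∑' i, 2 * ε i) := fun n hn => by
    have hgronwall := discrete_gronwall (u := fun n => 1 + a n) (by linarith [ha n₀]) hstep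
      (fun i _ => mul_nonneg zero_le_two (hε i)) (fun _ _ => le_rfl) hn
    rw [Finset.sum_const_zero, add_zero] at hgronwall
    refine (le_add_of_nonneg_left zero_le_one).trans (hgronwall.trans ?_)
    gcongr
    · linarith [ha n₀]
    · exact (hsum.mul_left 2).sum_le_tsum _ fun i _ => mul_nonneg zero_le_two (hε i)
  obtain ⟨M, hM⟩ := (isBoundedUnder_of_eventually_le
    (eventually_atTop.2 ⟨n₀, hbound⟩)).bddAbove_range
  exact ⟨M, fun n => hM ⟨n, rfl⟩⟩

theorem HasLocalGainBound.exists_forall_abs_belowGain_le {S : PricePath} (hS : HasLocalGainBound S)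
    (T : ℝ≥0) : ∃ M, ∀ n, ∀ t ≤ T, ∀ u, |belowGain S n t u| ≤ M := by
  obtain ⟨C, hC₀, hC⟩ := hS.exists_abs_belowGain_succ_sub_le T
  set a : ℕ → ℝ := fun n => ⨆ z : Set.Iic T × ℝ, |belowGain S n z.1 z.2|
  have hle : ∀ n, ∀ t ≤ T, ∀ u, |belowGain S n t u| ≤ a n := fun n t ht u => by
    obtain ⟨m, hm⟩ := exists_abs_belowGain_le S T n
    refine le_ciSup (f := fun z : Set.Iic T × ℝ => |belowGain S n z.1 z.2|) ?_ (⟨t, ht⟩, u)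
    exact ⟨m, Set.forall_mem_range.2 fun z => hm z.1 z.1.2 z.2⟩
  have hnonneg : ∀ n, 0 ≤ a n := fun n => (abs_nonneg _).trans (hle n 0 bot_le 0)
  have hε : ∀ n, 0 ≤ C * incrementRate (n + 1) := fun n => mul_nonneg hC₀ (incrementRate_nonneg _)
  have hsum : Summable fun n => C * incrementRate (n + 1) :=
    ((summable_nat_add_iff 1).2 summable_incrementRate).mul_left C
  obtain ⟨M, hM⟩ := exists_le_of_le_add_mul hnonneg hε hsum fun n => ciSup_le fun z => by
    linarith [abs_sub_abs_le_abs_sub (belowGain S (n + 1) z.1 z.2) (belowGain S n z.1 z.2),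
      hle n z.1 z.1.2 z.2, (hC n _ z.1 z.1.2).2 (hle (n + 1)) z.2]
  exact ⟨M, fun n t ht u => (hle n t ht u).trans (hM n)⟩

/-- The discrete local time along the dyadic Lebesgue partition of level `n`. -/
abbrev dyadicLocalTime (S : PricePath) (n : ℕ) : ℝ≥0 → ℝ → ℝ :=
  discreteLocalTime S (lebesguePartition S n)

theorem abs_dyadicLocalTime_le (S : PricePath) (n : ℕ) (t : ℝ≥0) (u : ℝ) :
    |dyadicLocalTime S n t u| ≤ |S t - S 0| + |belowGain S n t u| := by
  rw [dyadicLocalTime, discreteLocalTime_lebesguePartition]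
  refine (abs_add_le _ _).trans (add_le_add_left ?_ _)
  exact (abs_max_sub_max_le_abs _ _ _).trans_eq (by rw [sub_sub_sub_cancel_left, abs_sub_comm])

theorem abs_dyadicLocalTime_sub_le (S : PricePath) (n : ℕ) (t : ℝ≥0) (u v : ℝ) :
    |dyadicLocalTime S n t u - dyadicLocalTime S n t v| ≤
      2 * |u - v| + |belowGain S n t u - belowGain S n t v| := by
  have hmax : ∀ a : ℝ, |max (u - a) 0 - max (v - a) 0| ≤ |u - v| := fun a =>
    (abs_max_sub_max_le_abs _ _ _).trans_eq (by rw [sub_sub_sub_cancel_right])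
  rw [dyadicLocalTime, discreteLocalTime_lebesguePartition, discreteLocalTime_lebesguePartition]
  calc _ = |(max (u - S t) 0 - max (v - S t) 0) - (max (u - S 0) 0 - max (v - S 0) 0) +
        (belowGain S n t u - belowGain S n t v)| := by congr 1; ring
    _ ≤ |max (u - S t) 0 - max (v - S t) 0| + |max (u - S 0) 0 - max (v - S 0) 0| +
        |belowGain S n t u - belowGain S n t v| :=
      (abs_add_le _ _).trans (add_le_add_left (abs_sub _ _) _)
    _ ≤ _ := by linarith [hmax (S t), hmax (S 0)]

theorem dyadicLocalTime_succ_sub (S : PricePath) (n : ℕ) (t : ℝ≥0) (u : ℝ) :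
    dyadicLocalTime S (n + 1) t u - dyadicLocalTime S n t u =
      belowGain S (n + 1) t u - belowGain S n t u := by
  rw [dyadicLocalTime, discreteLocalTime_lebesguePartition, dyadicLocalTime,
    discreteLocalTime_lebesguePartition, add_sub_add_left_eq_sub]

theorem abs_belowGain_sub_le_of_abs_sub_le {S : PricePath} {n : ℕ} {t : ℝ≥0} {δ : ℝ}
    (hδ₀ : 0 ≤ δ) (hδ : ∀ k : ℤ, |belowGain S n t ((k + 1 : ℤ) * ((2 : ℝ) ^ n)⁻¹) -
      belowGain S n t (k * ((2 : ℝ) ^ n)⁻¹)| ≤ δ) {u v : ℝ} (huv : |u - v| ≤ ((2 : ℝ) ^ n)⁻¹) :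
    |belowGain S n t u - belowGain S n t v| ≤ δ + 2 * ((2 : ℝ) ^ n)⁻¹ := by
  wlog hle : v ≤ u generalizing u v
  · rw [abs_sub_comm]
    exact this (by rwa [abs_sub_comm]) (le_of_not_ge hle)
  have hpos : (0 : ℝ) < 2 ^ n := by positivity
  have hmono : ⌈v * 2 ^ n⌉ ≤ ⌈u * 2 ^ n⌉ := Int.ceil_mono (by gcongr)
  have hupper : ⌈u * 2 ^ n⌉ ≤ ⌈v * 2 ^ n⌉ + 1 := by
    have hdist : (u - v) * 2 ^ n ≤ 1 := by
      rw [← le_div_iff₀ hpos, one_div]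
      exact (le_abs_self _).trans huv
    rw [Int.ceil_le]
    push_cast
    linarith [Int.le_ceil (v * 2 ^ n)]
  have hgrid : |belowGain S n t (⌈u * 2 ^ n⌉ * ((2 : ℝ) ^ n)⁻¹) -
      belowGain S n t (⌈v * 2 ^ n⌉ * ((2 : ℝ) ^ n)⁻¹)| ≤ δ := by
    rcases hmono.eq_or_lt with heq | hlt
    · rwa [heq, sub_self, abs_zero]
    · rw [le_antisymm hupper hlt]
      exact hδ _
  have hu := abs_belowGain_sub_ceil_le S (le_refl n) t u
  have hv := abs_belowGain_sub_ceil_le S (le_refl n) t v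
  rw [abs_le] at hu hv hgrid ⊢
  constructor <;> linarith

theorem HasLocalGainBound.exists_dyadicLocalTime_estimates {S : PricePath}
    (hS : HasLocalGainBound S) (T : ℝ≥0) :
    ∃ C ≥ 0, ∀ n, ∀ t ≤ T, (∀ u, |dyadicLocalTime S n t u| ≤ C) ∧
      (∀ u v, |u - v| ≤ ((2 : ℝ) ^ n)⁻¹ →
        |dyadicLocalTime S n t u - dyadicLocalTime S n t v| ≤ C * incrementRate n) ∧
      ∀ u, |dyadicLocalTime S (n + 1) t u - dyadicLocalTime S n t u| ≤ C * incrementRate n := by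
  obtain ⟨R, hR⟩ := exists_abs_le S T
  obtain ⟨M, hM⟩ := hS.exists_forall_abs_belowGain_le T
  obtain ⟨C, hC₀, hC⟩ := hS.exists_abs_belowGain_succ_sub_le T
  have hR₀ : 0 ≤ R := (abs_nonneg _).trans (hR 0 bot_le)
  have hM₀ : 0 ≤ M := (abs_nonneg _).trans (hM 0 0 bot_le 0)
  have hCM : 0 ≤ C * (1 + M) := by positivity
  refine ⟨2 * R + M + 2 * (C * (1 + M)) + 4, by positivity, fun n t ht =>
    ⟨fun u => ?_, fun u v huv => ?_, fun u => ?_⟩⟩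
  · linarith [abs_dyadicLocalTime_le S n t u, abs_sub (S t) (S 0), hR t ht, hR 0 bot_le,
      hM n t ht u]
  · have hrate := incrementRate_nonneg n
    have hspace := abs_belowGain_sub_le_of_abs_sub_le (by positivity)
      ((hC n M t ht).1 (hM n)) huv
    nlinarith [abs_dyadicLocalTime_sub_le S n t u v, inv_two_pow_le_incrementRate n]
  · have hrate := incrementRate_nonneg n
    rw [dyadicLocalTime_succ_sub]
    calc _ ≤ C * incrementRate (n + 1) * (1 + M) := (hC n M t ht).2 (hM (n + 1)) u
      _ ≤ C * (2 * incrementRate n) * (1 + M) := by gcongr; exact incrementRate_succ_le n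
      _ = 2 * (C * (1 + M)) * incrementRate n := by ring
      _ ≤ _ := by gcongr; linarith

/-! ### The local time -/

theorem inv_two_pow_rpow (β : ℝ) (n : ℕ) : (((2 : ℝ) ^ n)⁻¹) ^ β = (((2 : ℝ) ^ β)⁻¹) ^ n := by
  rw [Real.inv_rpow (by positivity), inv_pow, Real.rpow_pow_comm zero_le_two]

theorem exists_incrementRate_le {β : ℝ} (hβ : β < 1 / 2) :
    ∃ K ≥ 0, ∀ n, incrementRate n ≤ K * (((2 : ℝ) ^ n)⁻¹) ^ β := by
  have hr : (√2)⁻¹ * 2 ^ β < 1 := by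
    rw [inv_mul_lt_one₀ (by positivity), Real.sqrt_eq_rpow]
    exact Real.rpow_lt_rpow_of_exponent_lt one_lt_two hβ
  obtain ⟨K, hK⟩ :=
    (summable_mul_pow_of_lt_one (by positivity) hr).tendsto_atTop_zero.bddAbove_range
  have hbound : ∀ n : ℕ, ((√2)⁻¹ * 2 ^ β) ^ n * (n + 1) ≤ K := fun n => hK ⟨n, rfl⟩
  refine ⟨K, le_trans (by positivity) (hbound 0), fun n => ?_⟩
  calc incrementRate n
      = ((√2)⁻¹ * 2 ^ β) ^ n * (n + 1) * (((2 : ℝ) ^ β)⁻¹) ^ n := by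
        rw [incrementRate, rootScale, mul_pow, inv_pow, inv_pow]
        field_simp
    _ ≤ K * (((2 : ℝ) ^ n)⁻¹) ^ β := by
        rw [inv_two_pow_rpow]
        gcongr
        exact hbound n

theorem tendsto_mul_inv_two_pow_rpow (C : ℝ) {β : ℝ} (hβ : 0 < β) :
    Tendsto (fun n : ℕ => C * (((2 : ℝ) ^ n)⁻¹) ^ β) atTop (𝓝 0) := by
  simp only [inv_two_pow_rpow]
  simpa only [mul_zero] using (tendsto_pow_atTop_nhds_zero_of_lt_one (by positivity)
    (inv_lt_one_of_one_lt₀ (Real.one_lt_rpow one_lt_two hβ))).const_mul C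

theorem abs_sub_le_rpow_of_dyadic {f : ℝ → ℝ} {C β : ℝ} (hβ₀ : 0 ≤ β) (hβ : β ≤ 1)
    (hf : ∀ u, |f u| ≤ C)
    (hdyadic : ∀ (n : ℕ) (u v), |u - v| ≤ ((2 : ℝ) ^ n)⁻¹ →
      |f u - f v| ≤ C * (((2 : ℝ) ^ n)⁻¹) ^ β) (u v : ℝ) :
    |f u - f v| ≤ 2 * C * |u - v| ^ β := by
  have hC : 0 ≤ C := (abs_nonneg _).trans (hf 0)
  rcases eq_or_ne u v with rfl | hne
  · rw [sub_self, abs_zero]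
    positivity
  have hpos : 0 < |u - v| := abs_pos.2 (sub_ne_zero.2 hne)
  rcases le_or_gt 1 |u - v| with hfar | hnear
  · calc |f u - f v| ≤ 2 * C := by linarith [abs_sub (f u) (f v), hf u, hf v]
      _ ≤ 2 * C * |u - v| ^ β := le_mul_of_one_le_right (by positivity) (Real.one_le_rpow hfar hβ₀)
  · obtain ⟨n, hlt, hle⟩ := exists_nat_pow_near_of_lt_one hpos hnear.le
      (y := (2 : ℝ)⁻¹) (by norm_num) (by norm_num)
    rw [inv_pow] at hlt hle
    have hmesh : ((2 : ℝ) ^ n)⁻¹ ≤ 2 * |u - v| := by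
      rw [pow_succ, mul_inv] at hlt
      linarith
    calc |f u - f v| ≤ C * (((2 : ℝ) ^ n)⁻¹) ^ β := hdyadic n u v hle
      _ ≤ C * (2 * |u - v|) ^ β := by gcongr
      _ ≤ C * (2 * |u - v| ^ β) := by
        rw [Real.mul_rpow zero_le_two hpos.le]
        gcongr
        exact Real.rpow_le_self_of_one_le one_le_two hβ
      _ = 2 * C * |u - v| ^ β := by ring

theorem abs_sub_limUnder_le {x : ℕ → ℝ} {A β : ℝ} (hβ : 0 < β)
    (hx : ∀ n, |x (n + 1) - x n| ≤ A * (((2 : ℝ) ^ n)⁻¹) ^ β) (n : ℕ) :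
    |x n - limUnder atTop x| ≤ A / (1 - ((2 : ℝ) ^ β)⁻¹) * (((2 : ℝ) ^ n)⁻¹) ^ β := by
  have hq : ((2 : ℝ) ^ β)⁻¹ < 1 := inv_lt_one_of_one_lt₀ (Real.one_lt_rpow one_lt_two hβ)
  have hdist : ∀ n, dist (x n) (x (n + 1)) ≤ A * (((2 : ℝ) ^ β)⁻¹) ^ n := fun n => by
    rw [dist_comm, Real.dist_eq, ← inv_two_pow_rpow]
    exact hx n
  rw [inv_two_pow_rpow, div_mul_eq_mul_div, ← Real.dist_eq]
  exact dist_le_of_le_geometric_of_tendsto _ _ hq hdist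
    (cauchySeq_of_le_geometric _ _ hq hdist).tendsto_limUnder n

/-- The local time of a path: the limit of its discrete local times along the dyadic Lebesgue
partitions. It is meaningful only where these converge, as they do for typical price paths. -/
def localTime (S : PricePath) (t : ℝ≥0) (u : ℝ) : ℝ :=
  limUnder atTop fun n => dyadicLocalTime S n t u

theorem HasLocalGainBound.exists_localTime_estimates {S : PricePath} (hS : HasLocalGainBound S)
    (T : ℝ≥0) {β : ℝ} (hβ₀ : 0 < β) (hβ : β < 1 / 2) :
    ∃ C ≥ 0, ∀ t ≤ T,
      (∀ n u, |dyadicLocalTime S n t u - localTime S t u| ≤ C * (((2 : ℝ) ^ n)⁻¹) ^ β) ∧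
      (∀ u, |localTime S t u| ≤ C) ∧
      ∀ u v, |localTime S t u - localTime S t v| ≤ C * |u - v| ^ β := by
  obtain ⟨C, hC₀, hC⟩ := hS.exists_dyadicLocalTime_estimates T
  obtain ⟨K, hK₀, hK⟩ := exists_incrementRate_le hβ
  have hratio : ((2 : ℝ) ^ β)⁻¹ ≤ 1 := inv_le_one_of_one_le₀ (Real.one_le_rpow one_le_two hβ₀.le)
  set D := C * K / (1 - ((2 : ℝ) ^ β)⁻¹)
  have hD : 0 ≤ D := div_nonneg (by positivity) (sub_nonneg.2 hratio)
  have hCK : ∀ n, C * incrementRate n ≤ C * K * (((2 : ℝ) ^ n)⁻¹) ^ β := fun n => by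
    rw [mul_assoc]
    exact mul_le_mul_of_nonneg_left (hK n) hC₀
  have hlim : ∀ n, ∀ t ≤ T, ∀ u,
      |dyadicLocalTime S n t u - localTime S t u| ≤ D * (((2 : ℝ) ^ n)⁻¹) ^ β :=
    fun n t ht u => abs_sub_limUnder_le (x := fun n => dyadicLocalTime S n t u) hβ₀
      (fun n => ((hC n t ht).2.2 u).trans (hCK n)) n
  have hle : ∀ t ≤ T, ∀ u, |localTime S t u| ≤ C + D := fun t ht u => by
    have hzero := hlim 0 t ht u
    rw [pow_zero, inv_one, Real.one_rpow, mul_one] at hzero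
    linarith [abs_sub_abs_le_abs_sub (localTime S t u) (dyadicLocalTime S 0 t u),
      abs_sub_comm (localTime S t u) (dyadicLocalTime S 0 t u), (hC 0 t ht).1 u]
  have hdyadic : ∀ t ≤ T, ∀ (n : ℕ) (u v), |u - v| ≤ ((2 : ℝ) ^ n)⁻¹ →
      |localTime S t u - localTime S t v| ≤ (2 * D + C * K) * (((2 : ℝ) ^ n)⁻¹) ^ β := by
    intro t ht n u v huv
    have hspace := ((hC n t ht).2.1 u v huv).trans (hCK n)
    have hu := hlim n t ht u
    have hv := hlim n t ht v
    rw [abs_le] at hspace hu hv ⊢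
    constructor <;> linarith
  refine ⟨2 * (C + 2 * D + C * K), by positivity, fun t ht => ⟨fun n u => ?_, fun u => ?_, ?_⟩⟩
  · refine (hlim n t ht u).trans (mul_le_mul_of_nonneg_right ?_ (by positivity))
    linarith [mul_nonneg hC₀ hK₀]
  · linarith [hle t ht u, mul_nonneg hC₀ hK₀]
  · refine abs_sub_le_rpow_of_dyadic hβ₀.le (by linarith) (fun u => ?_) fun n u v huv => ?_
    · linarith [hle t ht u, mul_nonneg hC₀ hK₀]
    · refine (hdyadic t ht n u v huv).trans (mul_le_mul_of_nonneg_right ?_ (by positivity))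
      linarith

theorem HasLocalGainBound.tendstoUniformlyOn_localTime {S : PricePath} (hS : HasLocalGainBound S)
    (T : ℝ≥0) :
    TendstoUniformlyOn (fun n (z : ℝ≥0 × ℝ) => dyadicLocalTime S n z.1 z.2)
      (fun z => localTime S z.1 z.2) atTop (Set.Icc 0 T ×ˢ Set.univ) := by
  obtain ⟨C, -, hC⟩ :=
    hS.exists_localTime_estimates T (β := 1 / 4) (by norm_num) (by norm_num)
  have hrate := tendsto_mul_inv_two_pow_rpow C (β := 1 / 4) (by norm_num)
  rw [Metric.tendstoUniformlyOn_iff]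
  intro ε hε
  filter_upwards [hrate.eventually_lt_const hε] with n hn z hz
  rw [dist_comm, Real.dist_eq]
  exact ((hC z.1 hz.1.2).1 n z.2).trans_lt hn

theorem HasLocalGainBound.exists_iSup_supNorm_le {S : PricePath} (hS : HasLocalGainBound S)
    (T : ℝ≥0) {β : ℝ} (hβ₀ : 0 < β) (hβ : β < 1 / 2) :
    ∃ C, 0 < C ∧ ⨆ n : ℕ, ENNReal.ofReal ((2 : ℝ) ^ (n * β)) *
      supNorm T (fun t u => dyadicLocalTime S n t u - localTime S t u) ≤ ENNReal.ofReal C := by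
  obtain ⟨C, hC₀, hC⟩ := hS.exists_localTime_estimates T hβ₀ hβ
  refine ⟨C + 1, by positivity, iSup_le fun n => ?_⟩
  have hsup : supNorm T (fun t u => dyadicLocalTime S n t u - localTime S t u) ≤
      ENNReal.ofReal (C * (((2 : ℝ) ^ n)⁻¹) ^ β) :=
    iSup₂_le fun t ht => iSup_le fun u => by
      rw [Real.enorm_eq_ofReal_abs]
      exact ENNReal.ofReal_le_ofReal ((hC t ht.2).1 n u)
  calc _ ≤ ENNReal.ofReal ((2 : ℝ) ^ (n * β)) * ENNReal.ofReal (C * (((2 : ℝ) ^ n)⁻¹) ^ β) := by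
        gcongr
    _ = ENNReal.ofReal C := by
        rw [← ENNReal.ofReal_mul (by positivity), Real.rpow_natCast_mul zero_le_two,
          Real.inv_rpow (by positivity)]
        congr 1
        field_simp
    _ ≤ ENNReal.ofReal (C + 1) := ENNReal.ofReal_le_ofReal (by linarith)

/-! ### Continuity of the local time in the Hölder spaces -/

theorem continuous_valueAtMin (S : PricePath) (τ : WithTop ℝ≥0) : Continuous (valueAtMin S τ) := by
  induction τ with
  | top =>
    exact S.continuous.congr fun t => (valueAtMin_of_ge le_top).symm
  | coe r => exact S.continuous.comp (continuous_id.min continuous_const)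

theorem tendstoUniformly_belowGain (S : PricePath) (n : ℕ) (t : ℝ≥0) :
    TendstoUniformly (belowGain S n) (belowGain S n t) (𝓝 t) := by
  obtain ⟨J, -, hJ⟩ := exists_lebesguePartition_le_lt S n (t + 1)
  set V : ℕ → ℝ≥0 → ℝ := fun k => valueAtMin S (lebesguePartition S n k)
  have hgain : ∀ s ≤ t + 1, ∀ u, belowGain S n s u =
      ∑ k ∈ Finset.range (J + 1), belowIndicator S n u k * (V (k + 1) s - V k s) :=
    fun s hs u => tsum_valueAtMin_eq_sum (lebesguePartition_mono S n)
      ((WithTop.coe_le_coe.2 hs).trans hJ.le) (fun k a b => belowIndicator S n u k * (b - a))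
      (by simp)
  have hlim : Tendsto (fun s => ∑ k ∈ Finset.range (J + 1),
      |(V (k + 1) s - V k s) - (V (k + 1) t - V k t)|) (𝓝 t) (𝓝 0) := by
    have hcont : Continuous fun s => ∑ k ∈ Finset.range (J + 1),
        |(V (k + 1) s - V k s) - (V (k + 1) t - V k t)| := by
      have hV : ∀ k, Continuous (V k) := fun k => continuous_valueAtMin S _
      fun_prop
    simpa using hcont.tendsto t
  rw [Metric.tendstoUniformly_iff]
  intro ε hε
  filter_upwards [hlim.eventually_lt_const hε, eventually_le_nhds (lt_add_one t)] with s hs hst u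
  rw [dist_comm, Real.dist_eq, hgain s hst, hgain t (by simp), ← Finset.sum_sub_distrib]
  refine (Finset.abs_sum_le_sum_abs _ _).trans_lt ((Finset.sum_le_sum fun k _ => ?_).trans_lt hs)
  rw [← mul_sub, abs_mul]
  exact mul_le_of_le_one_left (abs_nonneg _) (abs_belowIndicator_le_one S n u k)

theorem tendstoUniformly_dyadicLocalTime (S : PricePath) (n : ℕ) (t : ℝ≥0) :
    TendstoUniformly (dyadicLocalTime S n) (dyadicLocalTime S n t) (𝓝 t) := by
  have hcont := Metric.tendsto_nhds.1 (S.continuous.tendsto t)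
  have hgain := Metric.tendstoUniformly_iff.1 (tendstoUniformly_belowGain S n t)
  rw [Metric.tendstoUniformly_iff]
  intro ε hε
  filter_upwards [hcont (ε / 2) (half_pos hε), hgain (ε / 2) (half_pos hε)] with s hs hs' u
  have hmax : |max (u - S t) 0 - max (u - S s) 0| ≤ dist (S s) (S t) :=
    (abs_max_sub_max_le_abs _ _ _).trans_eq (by rw [sub_sub_sub_cancel_left, Real.dist_eq])
  have hsub := hs' u
  rw [Real.dist_eq, abs_lt] at hsub
  rw [abs_le] at hmax
  rw [Real.dist_eq, dyadicLocalTime, discreteLocalTime_lebesguePartition,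
    discreteLocalTime_lebesguePartition, abs_lt]
  constructor <;> linarith

theorem HasLocalGainBound.tendstoUniformly_localTime {S : PricePath} (hS : HasLocalGainBound S)
    {T t : ℝ≥0} (ht : t ≤ T) :
    TendstoUniformly (localTime S) (localTime S t) (𝓝[Set.Icc 0 T] t) := by
  rw [Metric.tendstoUniformly_iff]
  intro ε hε
  have hε₃ : 0 < ε / 3 := by positivity
  obtain ⟨n, hn⟩ := (Metric.tendstoUniformlyOn_iff.1
    (hS.tendstoUniformlyOn_localTime T) _ hε₃).exists
  have htime := Metric.tendstoUniformly_iff.1 (tendstoUniformly_dyadicLocalTime S n t) _ hε₃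
  filter_upwards [nhdsWithin_le_nhds htime, self_mem_nhdsWithin] with s hs hsT u
  have hlevel : ∀ r ≤ T, dist (localTime S r u) (dyadicLocalTime S n r u) < ε / 3 :=
    fun r hr => hn (r, u) ⟨⟨bot_le, hr⟩, trivial⟩
  calc _ ≤ _ := dist_triangle4_right _ _ (dyadicLocalTime S n t u) (dyadicLocalTime S n s u)
    _ < ε := by linarith [hlevel t ht, hlevel s hsT.2, hs u]

theorem holderWith_of_abs_sub_le {C r : ℝ≥0} {f : ℝ → ℝ}
    (h : ∀ u v, |f u - f v| ≤ C * |u - v| ^ (r : ℝ)) : HolderWith C r f := fun u v => by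
  rw [edist_dist, edist_dist, Real.dist_eq, Real.dist_eq,
    ENNReal.ofReal_rpow_of_nonneg (abs_nonneg _) r.coe_nonneg, ← ENNReal.ofReal_coe_nnreal,
    ← ENNReal.ofReal_mul C.coe_nonneg]
  exact ENNReal.ofReal_le_ofReal (h u v)

theorem holderSpaceNorm_le_interpolation {α β C δ : ℝ≥0} (hαβ : α < β) {f : ℝ → ℝ}
    (hf : ∀ u, |f u| ≤ δ) (hβ : HolderWith C β f) :
    holderSpaceNorm α f ≤
      (δ + (2 * δ) ^ (1 - α / β : ℝ) * C ^ (α / β : ℝ) : ℝ≥0) := by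
  have hβ₀ : β ≠ 0 := (bot_le.trans_lt hαβ).ne'
  have hzero : HolderWith (2 * δ) 0 f := holderWith_of_abs_sub_le fun u v => by
    rw [NNReal.coe_zero, Real.rpow_zero, mul_one, NNReal.coe_mul, NNReal.coe_ofNat]
    linarith [abs_sub (f u) (f v), hf u, hf v]
  have hratio : α / β ≤ 1 := div_le_one_of_le₀ hαβ.le bot_le
  have hinter := hzero.interpolate hβ (tsub_add_cancel_of_le hratio)
  rw [zero_mul, zero_add, mul_div_cancel₀ _ hβ₀, NNReal.coe_sub hratio, NNReal.coe_one,
    NNReal.coe_div] at hinter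
  rw [ENNReal.coe_add]
  refine add_le_add (iSup_le fun u => ?_) hinter.eHolderNorm_le
  rw [Real.enorm_eq_ofReal_abs, ← ENNReal.ofReal_coe_nnreal]
  exact ENNReal.ofReal_le_ofReal (hf u)

theorem isContinuousIntoHolder_of_tendstoUniformly {T α β C : ℝ≥0} (hαβ : α < β)
    {L : ℝ≥0 → ℝ → ℝ} (hbdd : ∀ t ≤ T, ∀ u, |L t u| ≤ C) (hL : ∀ t ≤ T, HolderWith C β (L t))
    (hcont : ∀ t ≤ T, TendstoUniformly L (L t) (𝓝[Set.Icc 0 T] t)) :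
    IsContinuousIntoHolder T α L := by
  refine ⟨fun t ht => (holderSpaceNorm_le_interpolation hαβ (hbdd t ht.2) (hL t ht.2)).trans_lt
    ENNReal.coe_lt_top, fun t ht => ENNReal.tendsto_nhds_zero.2 fun ε hε => ?_⟩
  have hratio : 0 < (1 - α / β : ℝ) :=
    sub_pos.2 ((div_lt_one (NNReal.coe_pos.2 (bot_le.trans_lt hαβ))).2 (NNReal.coe_lt_coe.2 hαβ))
  have hlim : Tendsto (fun δ : ℝ≥0 =>
      ((δ + (2 * δ) ^ (1 - α / β : ℝ) * (2 * C) ^ (α / β : ℝ) : ℝ≥0) : ℝ≥0∞)) (𝓝[>] 0) (𝓝 0) := by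
    have hcont₀ : Continuous fun δ : ℝ≥0 =>
        ((δ + (2 * δ) ^ (1 - α / β : ℝ) * (2 * C) ^ (α / β : ℝ) : ℝ≥0) : ℝ≥0∞) := by
      have hpow := NNReal.continuous_rpow_const hratio.le
      fun_prop
    refine (hcont₀.tendsto' 0 0 ?_).mono_left nhdsWithin_le_nhds
    rw [mul_zero, NNReal.zero_rpow hratio.ne', zero_mul, add_zero, ENNReal.coe_zero]
  obtain ⟨δ, hδε, hδ⟩ :=
    ((hlim.eventually_le_const hε).and self_mem_nhdsWithin).exists
  filter_upwards [Metric.tendstoUniformly_iff.1 (hcont t ht.2) δ (NNReal.coe_pos.2 hδ),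
    self_mem_nhdsWithin] with s hs hsT
  have hsmall : ∀ u, |L s u - L t u| ≤ δ := fun u => by
    rw [← Real.dist_eq, dist_comm]
    exact (hs u).le
  have hholder : HolderWith (2 * C) β fun u => L s u - L t u := by
    have hneg : HolderWith C β fun u => -L t u := fun u v =>
      (edist_neg_neg _ _).trans_le (hL t ht.2 u v)
    simpa only [sub_eq_add_neg, two_mul, Pi.add_def] using (hL s hsT.2).add hneg
  exact (holderSpaceNorm_le_interpolation hαβ hsmall hholder).trans hδε

theorem HasLocalGainBound.isContinuousIntoHolder_localTime {S : PricePath}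
    (hS : HasLocalGainBound S) (T : ℝ≥0) {α : ℝ≥0} (hα : (α : ℝ) < 1 / 2) :
    IsContinuousIntoHolder T α (localTime S) := by
  obtain ⟨β, hαβ, hβ⟩ := exists_between hα
  have hβ₀ : 0 < β := α.coe_nonneg.trans_lt hαβ
  lift β to ℝ≥0 using hβ₀.le
  obtain ⟨C, hC₀, hC⟩ := hS.exists_localTime_estimates T hβ₀ hβ
  lift C to ℝ≥0 using hC₀
  exact isContinuousIntoHolder_of_tendstoUniformly (NNReal.coe_lt_coe.1 hαβ)
    (fun t ht => (hC t ht).2.1) (fun t ht => holderWith_of_abs_sub_le (hC t ht).2.2)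
    fun t ht => hS.tendstoUniformly_localTime ht

/-! ### `p`-variation of the discrete local times -/

theorem pVariation_le_of_abs_sub_le {p c D : ℝ} (hp : 0 < p) {f G : ℝ → ℝ}
    (hG : Monotone G) (hD : ∀ u v, G v - G u ≤ D) (hc : 0 ≤ c)
    (hf : ∀ u v, u ≤ v → |f v - f u| ≤ c * (G v - G u) ^ (1 / p)) :
    pVariation p f ≤ ENNReal.ofReal (c ^ p * D) ^ (1 / p) := by
  refine iSup_le fun N => iSup₂_le fun u hu => ENNReal.rpow_le_rpow ?_ (by positivity)
  have hstep : ∀ k : Fin N,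
      |f (u k.succ) - f (u k.castSucc)| ^ p ≤ c ^ p * (G (u k.succ) - G (u k.castSucc)) := by
    intro k
    have hle : u k.castSucc ≤ u k.succ := hu.monotone Fin.castSucc_lt_succ.le
    have hinc : 0 ≤ G (u k.succ) - G (u k.castSucc) := sub_nonneg.2 (hG hle)
    calc _ ≤ (c * (G (u k.succ) - G (u k.castSucc)) ^ (1 / p)) ^ p := by
          gcongr
          exact hf _ _ hle
      _ = _ := by
          rw [Real.mul_rpow hc (by positivity), ← Real.rpow_mul hinc, one_div_mul_cancel hp.ne',
            Real.rpow_one]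
  have htelescope : ∑ k : Fin N, (G (u k.succ) - G (u k.castSucc)) =
      G (u (Fin.last N)) - G (u 0) := by
    rw [Finset.sum_sub_distrib]
    linarith [Fin.sum_univ_succ fun k => G (u k), Fin.sum_univ_castSucc fun k => G (u k)]
  calc ∑ k : Fin N, ‖f (u k.succ) - f (u k.castSucc)‖ₑ ^ p
      = ENNReal.ofReal (∑ k : Fin N, |f (u k.succ) - f (u k.castSucc)| ^ p) := by
        rw [ENNReal.ofReal_sum_of_nonneg fun k _ => by positivity]
        simp only [Real.enorm_eq_ofReal_abs, ENNReal.ofReal_rpow_of_nonneg (abs_nonneg _) hp.le]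
    _ ≤ ENNReal.ofReal (c ^ p * ∑ k : Fin N, (G (u k.succ) - G (u k.castSucc))) := by
        rw [Finset.mul_sum]
        exact ENNReal.ofReal_le_ofReal (Finset.sum_le_sum fun k _ => hstep k)
    _ ≤ ENNReal.ofReal (c ^ p * D) := by
        rw [htelescope]
        gcongr
        exact hD _ _

theorem monotone_belowIndicator (S : PricePath) (n l : ℕ) :
    Monotone fun u => belowIndicator S n u l := fun u v huv => by
  rcases lt_or_ge (skeleton S n l) u with hu | hu
  · exact (belowIndicator_mem_Icc S n u l).2.trans_eq (if_pos (hu.trans_le huv)).symm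
  · exact (if_neg hu.not_gt).trans_le (belowIndicator_mem_Icc S n v l).1

/-- A nondecreasing function of space, bounded on bounded intervals uniformly in the level `n`,
whose increments control those of the discrete local times of level `n`. The second summand accounts
for the jump of the discrete local time at `S 0`, the third one for the jumps at grid points. -/
def spaceControl (S : PricePath) (n : ℕ) (u : ℝ) : ℝ :=
  u + belowIndicator S n u 0 + ⌈u * 2 ^ n⌉ * ((2 : ℝ) ^ n)⁻¹

theorem monotone_spaceControl (S : PricePath) (n : ℕ) : Monotone (spaceControl S n) :=
  (monotone_id.add (monotone_belowIndicator S n 0)).add fun u v huv => by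
    gcongr

theorem ceil_mul_inv_mem_Icc (n : ℕ) (u : ℝ) :
    ⌈u * 2 ^ n⌉ * ((2 : ℝ) ^ n)⁻¹ ∈ Set.Icc u (u + ((2 : ℝ) ^ n)⁻¹) := by
  have hpos : (0 : ℝ) < 2 ^ n := by positivity
  rw [← div_eq_mul_inv]
  refine ⟨(le_div_iff₀ hpos).2 (Int.le_ceil _), (div_le_iff₀ hpos).2 ?_⟩
  rw [add_mul, inv_mul_cancel₀ hpos.ne']
  exact (Int.ceil_lt_add_one _).le

theorem spaceControl_sub_le (S : PricePath) (n : ℕ) (u v : ℝ) :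
    spaceControl S n v - spaceControl S n u ≤ 2 * (v - u) + 2 := by
  have hindicator := le_of_abs_le (abs_belowIndicator_sub_le_one S n v u 0)
  rw [spaceControl, spaceControl]
  linarith [(ceil_mul_inv_mem_Icc n v).2, (ceil_mul_inv_mem_Icc n u).1, inv_two_pow_le_one n]

theorem abs_dyadicLocalTime_sub_le_of_ceil_eq (S : PricePath) (n : ℕ) (t : ℝ≥0) {β : ℝ}
    (hβ₀ : 0 ≤ β) (hβ : β ≤ 1) {u v : ℝ} (huv : u ≤ v) (hceil : ⌈v * 2 ^ n⌉ = ⌈u * 2 ^ n⌉) :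
    |dyadicLocalTime S n t v - dyadicLocalTime S n t u| ≤
      3 * (spaceControl S n v - spaceControl S n u) ^ β := by
  have hb : 0 ≤ belowIndicator S n v 0 - belowIndicator S n u 0 :=
    sub_nonneg.2 (monotone_belowIndicator S n 0 huv)
  have hb' := le_of_abs_le (abs_belowIndicator_sub_le_one S n v u 0)
  have hdist : v - u ≤ 1 := by
    have hv := (ceil_mul_inv_mem_Icc n v).1
    rw [hceil] at hv
    linarith [(ceil_mul_inv_mem_Icc n u).2, inv_two_pow_le_one n]
  have hcontrol : spaceControl S n v - spaceControl S n u =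
      (v - u) + (belowIndicator S n v 0 - belowIndicator S n u 0) := by
    rw [spaceControl, spaceControl, hceil]
    ring
  have hle : ∀ a, 0 ≤ a → a ≤ 1 → a ≤ spaceControl S n v - spaceControl S n u →
      a ≤ (spaceControl S n v - spaceControl S n u) ^ β := fun a ha ha' hle =>
    (Real.self_le_rpow_of_le_one ha ha' hβ).trans (Real.rpow_le_rpow ha hle hβ₀)
  have hgain := abs_belowGain_sub_le_of_ceil_eq S le_rfl t hceil
  rw [abs_of_nonneg hb] at hgain
  have hspace := abs_dyadicLocalTime_sub_le S n t v u
  rw [abs_of_nonneg (sub_nonneg.2 huv)] at hspace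
  linarith [mul_le_of_le_one_right hb (inv_two_pow_le_one n),
    hle _ (sub_nonneg.2 huv) hdist (by linarith), hle _ hb hb' (by linarith)]

theorem HasLocalGainBound.exists_abs_dyadicLocalTime_sub_le_spaceControl {S : PricePath}
    (hS : HasLocalGainBound S) (T : ℝ≥0) {β : ℝ} (hβ₀ : 0 < β) (hβ : β < 1 / 2) :
    ∃ C ≥ 0, ∀ n, ∀ t ≤ T, ∀ u v, u ≤ v →
      |dyadicLocalTime S n t v - dyadicLocalTime S n t u| ≤
        C * (spaceControl S n v - spaceControl S n u) ^ β := by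
  obtain ⟨C, hC₀, hC⟩ := hS.exists_localTime_estimates T hβ₀ hβ
  refine ⟨3 * C + 3, by positivity, fun n t ht u v huv => ?_⟩
  obtain ⟨hlevel, -, hspace⟩ := hC t ht
  have hw := sub_nonneg.2 (monotone_spaceControl S n huv)
  have hmono : ⌈u * 2 ^ n⌉ ≤ ⌈v * 2 ^ n⌉ := Int.ceil_mono (by gcongr)
  rcases hmono.eq_or_lt with hceil | hceil
  · refine (abs_dyadicLocalTime_sub_le_of_ceil_eq S n t hβ₀.le (by linarith) huv
      hceil.symm).trans ?_
    gcongr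
    linarith
  have hjump : 0 ≤ belowIndicator S n v 0 - belowIndicator S n u 0 :=
    sub_nonneg.2 (monotone_belowIndicator S n 0 huv)
  have hgrid : ((2 : ℝ) ^ n)⁻¹ ≤
      ⌈v * 2 ^ n⌉ * ((2 : ℝ) ^ n)⁻¹ - ⌈u * 2 ^ n⌉ * ((2 : ℝ) ^ n)⁻¹ := by
    rw [← sub_mul]
    refine le_mul_of_one_le_left (by positivity) ?_
    rw [le_sub_iff_add_le']
    exact_mod_cast hceil
  have hinv : 0 ≤ ((2 : ℝ) ^ n)⁻¹ := by positivity
  have hmesh : ((2 : ℝ) ^ n)⁻¹ ≤ spaceControl S n v - spaceControl S n u := by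
    rw [spaceControl, spaceControl]
    linarith
  have hdist : |v - u| ≤ spaceControl S n v - spaceControl S n u := by
    rw [abs_of_nonneg (sub_nonneg.2 huv), spaceControl, spaceControl]
    linarith
  set w := spaceControl S n v - spaceControl S n u
  have hrate : C * (((2 : ℝ) ^ n)⁻¹) ^ β ≤ C * w ^ β := by gcongr
  have hholder : C * |v - u| ^ β ≤ C * w ^ β := by gcongr
  have hu := hlevel n u
  have hv := hlevel n v
  have huv := hspace v u
  have hpow : 0 ≤ w ^ β := by positivity
  rw [abs_le] at hu hv huv ⊢
  constructor <;> linarith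

theorem dyadicLocalTime_eq_zero {S : PricePath} {T t : ℝ≥0} {R : ℝ} (hR : ∀ t ≤ T, |S t| ≤ R)
    (n : ℕ) (ht : t ≤ T) {u : ℝ} (hu : R < |u|) : dyadicLocalTime S n t u = 0 := by
  have hSt := abs_le.1 (hR t ht)
  have hS₀ := abs_le.1 (hR 0 bot_le)
  rw [dyadicLocalTime, discreteLocalTime_lebesguePartition]
  rcases lt_abs.1 hu with hu | hu
  · rw [belowGain_of_lt hR n ht hu, max_eq_left (by linarith), max_eq_left (by linarith)]
    ring
  · rw [belowGain_of_le hR n ht (by linarith), max_eq_right (by linarith),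
      max_eq_right (by linarith)]
    ring

theorem apply_projIcc_eq {f : ℝ → ℝ} {r : ℝ} (hr : -r ≤ r) (hf : ∀ u, r ≤ |u| → f u = 0) (u : ℝ) :
    f (Set.projIcc (-r) r hr u) = f u := by
  have hr₀ : 0 ≤ r := by linarith
  rcases le_or_gt r |u| with hu | hu
  · rw [hf u hu]
    refine hf _ ?_
    rcases le_abs.1 hu with hu | hu
    · rw [Set.projIcc_of_right_le hr hu, abs_of_nonneg hr₀]
    · rw [Set.projIcc_of_le_left hr (by linarith), abs_neg, abs_of_nonneg hr₀]
  · rw [Set.projIcc_of_mem hr (abs_le.1 hu.le)]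

theorem HasLocalGainBound.iSup_pVariation_lt_top {S : PricePath} (hS : HasLocalGainBound S)
    (T : ℝ≥0) {p : ℝ} (hp : 2 < p) :
    ⨆ n, ⨆ t ∈ Set.Icc 0 T, pVariation p (dyadicLocalTime S n t) < ∞ := by
  have hp₀ : 0 < p := by linarith
  obtain ⟨R, hR⟩ := exists_abs_le S T
  have hR₀ : 0 ≤ R := (abs_nonneg _).trans (hR 0 bot_le)
  obtain ⟨C, hC₀, hC⟩ := hS.exists_abs_dyadicLocalTime_sub_le_spaceControl T (β := 1 / p)
    (by positivity) (one_div_lt_one_div_of_lt two_pos hp)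
  have hr : -(R + 1) ≤ R + 1 := by linarith
  set proj : ℝ → ℝ := fun u => Set.projIcc (-(R + 1)) (R + 1) hr u
  have hproj : Monotone proj := fun u v huv => Set.monotone_projIcc hr huv
  have hle : ∀ n, ∀ t ∈ Set.Icc 0 T, pVariation p (dyadicLocalTime S n t) ≤
      ENNReal.ofReal (C ^ p * (4 * (R + 1) + 2)) ^ (1 / p) := by
    intro n t ht
    have hlocal : ∀ u, dyadicLocalTime S n t (proj u) = dyadicLocalTime S n t u :=
      apply_projIcc_eq hr fun u hu => dyadicLocalTime_eq_zero hR n ht.2 (by linarith)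
    refine pVariation_le_of_abs_sub_le hp₀ ((monotone_spaceControl S n).comp hproj)
      (fun u v => (spaceControl_sub_le S n _ _).trans ?_) hC₀ fun u v huv => ?_
    · linarith [(Set.projIcc (-(R + 1)) (R + 1) hr u).2.1,
        (Set.projIcc (-(R + 1)) (R + 1) hr v).2.2]
    · rw [← hlocal u, ← hlocal v]
      exact hC n t ht.2 _ _ (hproj huv)
  exact (iSup_le fun n => iSup₂_le (hle n)).trans_lt
    (ENNReal.rpow_lt_top_of_nonneg (by positivity) ENNReal.ofReal_ne_top)

end

end VovkLocalTime

theorem theorem3p2 (T : ℝ≥0) (hT : 0 < T) (α : ℝ≥0) (hα₀ : 0 < α) (hα : α < 1 / 2) :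
    VovkLocalTime.ForTypicalPaths (fun S : VovkLocalTime.PricePath =>
      ∃ L : ℝ≥0 → ℝ → ℝ,
        TendstoUniformlyOn
          (fun (n : ℕ) (z : ℝ≥0 × ℝ) => VovkLocalTime.discreteLocalTime S
            (VovkLocalTime.lebesguePartition S n) z.1 z.2)
          (fun z : ℝ≥0 × ℝ => L z.1 z.2) atTop (Set.Icc 0 T ×ˢ Set.univ) ∧
        VovkLocalTime.IsContinuousIntoHolder T α L ∧
        ∃ C : ℝ, 0 < C ∧
          (⨆ n : ℕ, ENNReal.ofReal ((2 : ℝ) ^ ((n : ℝ) * (α : ℝ))) *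
            VovkLocalTime.supNorm T (fun t u => VovkLocalTime.discreteLocalTime S
              (VovkLocalTime.lebesguePartition S n) t u - L t u)) ≤ ENNReal.ofReal C) ∧
    ∀ p : ℝ, 2 < p →
      VovkLocalTime.ForTypicalPaths (fun S : VovkLocalTime.PricePath =>
        (⨆ n : ℕ, ⨆ t ∈ Set.Icc 0 T,
          VovkLocalTime.pVariation p (VovkLocalTime.discreteLocalTime S
            (VovkLocalTime.lebesguePartition S n) t)) < ∞) := by
  have hα' : (α : ℝ) < 1 / 2 := by exact_mod_cast hα
  constructor
  · exact VovkLocalTime.forTypicalPaths_hasLocalGainBound.mono fun S hS =>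
      ⟨VovkLocalTime.localTime S, hS.tendstoUniformlyOn_localTime T,
        hS.isContinuousIntoHolder_localTime T hα',
        hS.exists_iSup_supNorm_le T (NNReal.coe_pos.2 hα₀) hα'⟩
  · exact fun p hp => VovkLocalTime.forTypicalPaths_hasLocalGainBound.mono fun S hS =>
      hS.iSup_pVariation_lt_top T hp
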